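/- Fix a free ultrafilter $\omega$ on $\mathbb N$. Let $A$ be a separable (not necessarily unital) $C^*$-algebra whose set $T(A)$ of tracial states is non-empty and weak$^*$-compact. For $\tau\in T(A)$ write $\|a\|_{2,\tau}=\tau(a^*a)^{1/2}$, and let $\|a\|_{2,T(A)}=\sup_{\tau\in T(A)}\|a\|_{2,\tau}$. Let $$A^\omega=\ell^\infty(A)\big/\{(a_m)_m:\lim_{m\to\omega}\|a_m\|_{2,T(A)}=0\}$$ be the uniform tracial ultrapower (which is unital because $T(A)$ is compact), let $\iota:A\to A^\omega$ be the map given by constant sequences, and write $A^\omega\cap A'$ for the commutant of $\iota(A)$ in $A^\omega$. Let $T_\omega(A)$ be the set of limit traces on $A^\omega$, i.e. the functionals $(a_m)_m\mapsto\lim_{m\to\omega}\tau_m(a_m)$ for sequences $(\tau_m)_m$ in $T(A)$. Suppose that $A$ has complemented partitions of unity (CPoU): for every $k\ge 1$, all positive elements $a_1,\dots,a_k\in A^\omega$ and every real number $\delta$ with $$\delta>\sup_{\tau\in T_\omega(A)}\min\{\tau(a_1),\dots,\tau(a_k)\},$$ there are pairwise orthogonal projections $p_1,\dots,p_k\in A^\omega\cap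 A'$ with $p_1+\dots+p_k=1_{A^\omega}$ and $\tau(p_ia_i)\le\delta\,\tau(p_i)$ for all $i=1,\dots,k$ and all $\tau\in T_\omega(A)$. Suppose moreover that for every $\tau\in T(A)$, with GNS representation $\pi_\tau$, the von Neumann algebra $\mathcal M_\tau=\pi_\tau(A)''$ is McDuff in the following sense: for every $n\ge1$ there is a unital embedding (an injective unital $*$-homomorphism) $M_n(\mathbb C)\to\mathcal M_\tau^\omega\cap\pi_\tau(A)'$, where $$\mathcal M_\tau^\omega=\ell^\infty(\mathcal M_\tau)\big/\{(x_m)_m:\lim_{m\to\omega}\|x_m\|_{2,\tau}=0\}$$ is the tracial ultrapower with respect to the canonical trace on $\mathcal M_\tau$ induced by $\tau$, and $\pi_\tau(A)$ is embedded in it as constant sequences. Then $A$ is uniformly McDuff: for every $n\ge1$ there is a unital embedding $M_n(\mathbb C)\to A^\omega\cap A'$. -/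

import Mathlib

open scoped ComplexOrder InnerProductSpace Topology lp ENNReal
open Filter

noncomputable section

namespace UniformTracial

universe u

/-! ### Tracial states and the associated 2-seminorms -/

section Traces

variable {B : Type u} [NonUnitalCStarAlgebra B]

variable (B) in
/-- `T(B)`: the tracial states on the (not necessarily unital) `C⋆`-algebra `B`, that is, the
positive functionals of norm one with `τ (a b) = τ (b a)`, as a subset of the dual of `B` with its
weak-⋆ topology. -/
def traceSpace : Set (WeakDual ℂ B) :=
  {τ | (∀ a, 0 ≤ τ (star a * a)) ∧ ‖WeakDual.toStrongDual τ‖ = 1 ∧ ∀ a b, τ (a * b) = τ (b * a)}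

/-- The 2-seminorm `‖a‖_{2,τ} = τ(a⋆a)^{1/2}`. -/
def twoNorm (τ : traceSpace B) (a : B) : ℝ := √(τ.1 (star a * a)).re

/-- The uniform 2-seminorm `‖a‖_{2,X} = sup_{τ ∈ X} ‖a‖_{2,τ}`. -/
def uniformTwoNorm (X : Set (traceSpace B)) (a : B) : ℝ := ⨆ τ : X, twoNorm τ.1 a

/-- A tracial state, as a positive linear map. -/
def toPositive [PartialOrder B] [StarOrderedRing B] (τ : traceSpace B) : B →ₚ[ℂ] ℂ :=
  PositiveLinearMap.mk₀ (τ.1 : B →ₗ[ℂ] ℂ) fun x hx => by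
    obtain ⟨y, rfl⟩ := CStarAlgebra.nonneg_iff_eq_star_mul_self.mp hx
    exact τ.2.1 y

section Ordered

variable [PartialOrder B] [StarOrderedRing B]

theorem toPositive_apply (τ : traceSpace B) (a : B) : toPositive τ a = τ.1 a := rfl

theorem twoNorm_eq_norm (τ : traceSpace B) (a : B) :
    twoNorm τ a = ‖(toPositive τ).toPreGNS a‖ := rfl

end Ordered

theorem norm_trace_le (τ : traceSpace B) (a : B) : ‖τ.1 a‖ ≤ ‖a‖ := by
  have h := (WeakDual.toStrongDual τ.1).le_opNorm a
  rw [τ.2.2.1, one_mul] at h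
  exact h

theorem twoNorm_nonneg (τ : traceSpace B) (a : B) : 0 ≤ twoNorm τ a := Real.sqrt_nonneg _

theorem twoNorm_le (τ : traceSpace B) (a : B) : twoNorm τ a ≤ ‖a‖ := by
  refine Real.sqrt_le_iff.mpr ⟨norm_nonneg _, ?_⟩
  calc _ ≤ ‖τ.1 (star a * a)‖ := Complex.re_le_norm _
    _ ≤ ‖star a * a‖ := norm_trace_le _ _
    _ = ‖a‖ ^ 2 := by rw [CStarRing.norm_star_mul_self, sq]

theorem twoNorm_zero (τ : traceSpace B) : twoNorm τ 0 = 0 := by simp [twoNorm]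

theorem twoNorm_star (τ : traceSpace B) (a : B) : twoNorm τ (star a) = twoNorm τ a := by
  simp [twoNorm, τ.2.2.2 a (star a)]

theorem twoNorm_smul (τ : traceSpace B) (c : ℂ) (a : B) :
    twoNorm τ (c • a) = ‖c‖ * twoNorm τ a := by
  let _ := CStarAlgebra.spectralOrder B
  let _ := CStarAlgebra.spectralOrderedRing B
  simp only [twoNorm_eq_norm, map_smul, norm_smul]

theorem twoNorm_add_le (τ : traceSpace B) (a b : B) :
    twoNorm τ (a + b) ≤ twoNorm τ a + twoNorm τ b := by
  let _ := CStarAlgebra.spectralOrder B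
  let _ := CStarAlgebra.spectralOrderedRing B
  simp only [twoNorm_eq_norm, map_add]
  exact norm_add_le _ _

theorem twoNorm_mul_le_left (τ : traceSpace B) (a b : B) :
    twoNorm τ (a * b) ≤ ‖a‖ * twoNorm τ b := by
  let _ := CStarAlgebra.spectralOrder B
  let _ := CStarAlgebra.spectralOrderedRing B
  simp only [twoNorm_eq_norm]
  refine (((toPositive τ).leftMulMapPreGNS a).le_opNorm ((toPositive τ).toPreGNS b)).trans ?_
  gcongr
  exact LinearMap.mkContinuous_norm_le _ (norm_nonneg _) _

theorem twoNorm_mul_le_right (τ : traceSpace B) (a b : B) :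
    twoNorm τ (a * b) ≤ ‖b‖ * twoNorm τ a := by
  rw [← twoNorm_star, star_mul, ← norm_star b, ← twoNorm_star τ a]
  exact twoNorm_mul_le_left _ _ _

/-- Cauchy--Schwarz for tracial states. -/
theorem norm_trace_le_twoNorm (τ : traceSpace B) (a : B) : ‖τ.1 a‖ ≤ twoNorm τ a := by
  let _ := CStarAlgebra.spectralOrder B
  let _ := CStarAlgebra.spectralOrderedRing B
  have hl := CStarAlgebra.increasingApproximateUnit B
  have ht : Tendsto (fun e => ‖τ.1 (e * a)‖) (CStarAlgebra.approximateUnit B) (𝓝 ‖τ.1 a‖) :=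
    ((map_continuous τ.1).tendsto a |>.comp (hl.tendsto_mul_right a)).norm
  refine le_of_tendsto ht ?_
  filter_upwards [hl.eventually_norm, hl.eventually_star_eq] with e he hs
  have h := norm_inner_le_norm (𝕜 := ℂ) ((toPositive τ).toPreGNS e) ((toPositive τ).toPreGNS a)
  rw [PositiveLinearMap.preGNS_inner_def, ← twoNorm_eq_norm, ← twoNorm_eq_norm] at h
  simp only [PositiveLinearMap.ofPreGNS_toPreGNS, hs, toPositive_apply] at h
  refine h.trans ?_
  have := (twoNorm_le τ e).trans he
  exact mul_le_of_le_one_left (twoNorm_nonneg _ _) this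

section Uniform

variable (X : Set (traceSpace B))

theorem bddAbove_twoNorm (a : B) : BddAbove (Set.range fun τ : X => twoNorm τ.1 a) :=
  ⟨‖a‖, by rintro _ ⟨τ, rfl⟩; exact twoNorm_le _ _⟩

variable {X} in
theorem twoNorm_le_uniform {τ : traceSpace B} (h : τ ∈ X) (a : B) :
    twoNorm τ a ≤ uniformTwoNorm X a :=
  le_ciSup (bddAbove_twoNorm X a) ⟨τ, h⟩

theorem uniformTwoNorm_nonneg (a : B) : 0 ≤ uniformTwoNorm X a :=
  Real.iSup_nonneg fun _ => twoNorm_nonneg _ _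

theorem uniformTwoNorm_zero : uniformTwoNorm X 0 = 0 := by
  simp [uniformTwoNorm, twoNorm_zero]

theorem uniformTwoNorm_add_le (a b : B) :
    uniformTwoNorm X (a + b) ≤ uniformTwoNorm X a + uniformTwoNorm X b :=
  Real.iSup_le (fun τ => (twoNorm_add_le _ _ _).trans
    (add_le_add (twoNorm_le_uniform τ.2 a) (twoNorm_le_uniform τ.2 b)))
    (add_nonneg (uniformTwoNorm_nonneg _ _) (uniformTwoNorm_nonneg _ _))

theorem uniformTwoNorm_star (a : B) : uniformTwoNorm X (star a) = uniformTwoNorm X a := by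
  simp [uniformTwoNorm, twoNorm_star]

theorem uniformTwoNorm_smul (c : ℂ) (a : B) :
    uniformTwoNorm X (c • a) = ‖c‖ * uniformTwoNorm X a := by
  simp only [uniformTwoNorm, twoNorm_smul]
  exact (Real.mul_iSup_of_nonneg (norm_nonneg c) _).symm

theorem uniformTwoNorm_mul_le_left (a b : B) :
    uniformTwoNorm X (a * b) ≤ ‖a‖ * uniformTwoNorm X b :=
  Real.iSup_le (fun τ => (twoNorm_mul_le_left _ _ _).trans
    (mul_le_mul_of_nonneg_left (twoNorm_le_uniform τ.2 b) (norm_nonneg _)))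
    (mul_nonneg (norm_nonneg _) (uniformTwoNorm_nonneg _ _))

theorem uniformTwoNorm_mul_le_right (a b : B) :
    uniformTwoNorm X (a * b) ≤ ‖b‖ * uniformTwoNorm X a :=
  Real.iSup_le (fun τ => (twoNorm_mul_le_right _ _ _).trans
    (mul_le_mul_of_nonneg_left (twoNorm_le_uniform τ.2 a) (norm_nonneg _)))
    (mul_nonneg (norm_nonneg _) (uniformTwoNorm_nonneg _ _))

end Uniform

end Traces

/-! ### Tracial ultrapowers -/

section Ultrapower

variable {B : Type u} [NonUnitalCStarAlgebra B] (ω : Ultrafilter ℕ) (X : Set (traceSpace B))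

/-- The ideal of all bounded sequences `(xₙ)` in `B` with `lim_{n → ω} ‖xₙ‖_{2,X} = 0`. -/
def nullIdeal : TwoSidedIdeal ℓ^∞(ℕ, B) :=
  .mk' {x | Tendsto (fun n => uniformTwoNorm X (x n)) ω (𝓝 0)}
    (by simp [uniformTwoNorm_zero])
    (fun {x y} hx hy => squeeze_zero (fun _ => uniformTwoNorm_nonneg _ _)
      (fun n => uniformTwoNorm_add_le X (x n) (y n)) (by simpa using Tendsto.add hx hy))
    (fun {x} hx => by
      have h : ∀ n, uniformTwoNorm X ((-x) n) = uniformTwoNorm X (x n) := fun n => by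
        simpa using uniformTwoNorm_smul X (-1) (x n)
      simpa only [Set.mem_ofPred_eq, h] using hx)
    (fun {x y} hy => squeeze_zero (fun _ => uniformTwoNorm_nonneg _ _)
      (fun n => (uniformTwoNorm_mul_le_left X (x n) (y n)).trans
        (mul_le_mul_of_nonneg_right (lp.norm_apply_le_norm (by simp) x n)
          (uniformTwoNorm_nonneg _ _)))
      (by simpa using Tendsto.const_mul ‖x‖ hy))
    (fun {x y} hx => squeeze_zero (fun _ => uniformTwoNorm_nonneg _ _)
      (fun n => (uniformTwoNorm_mul_le_right X (x n) (y n)).trans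
        (mul_le_mul_of_nonneg_right (lp.norm_apply_le_norm (by simp) y n)
          (uniformTwoNorm_nonneg _ _)))
      (by simpa using Tendsto.const_mul ‖y‖ hx))

theorem mem_nullIdeal {x : ℓ^∞(ℕ, B)} :
    x ∈ nullIdeal ω X ↔ Tendsto (fun n => uniformTwoNorm X (x n)) ω (𝓝 0) := by
  simp [nullIdeal]

/-- The tracial ultrapower `ℓ^∞(B) / {(xₙ) : lim_{n → ω} ‖xₙ‖_{2,X} = 0}` of `B` with respect to
a set `X` of tracial states; a (possibly non-unital) complex `⋆`-algebra. -/
def TracialUltrapower : Type u := (nullIdeal ω X).ringCon.Quotient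

namespace TracialUltrapower

instance : NonUnitalRing (TracialUltrapower ω X) :=
  inferInstanceAs (NonUnitalRing (nullIdeal ω X).ringCon.Quotient)

/-- The class of a bounded sequence. -/
def mk : ℓ^∞(ℕ, B) →ₙ+* TracialUltrapower ω X where
  toFun x := ((x : (nullIdeal ω X).ringCon.Quotient))
  map_mul' _ _ := rfl
  map_zero' := rfl
  map_add' _ _ := rfl

theorem mk_surjective : Function.Surjective (mk ω X) := Quotient.mk''_surjective

theorem mk_eq_mk {x y : ℓ^∞(ℕ, B)} :
    mk ω X x = mk ω X y ↔ Tendsto (fun n => uniformTwoNorm X (x n - y n)) ω (𝓝 0) :=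
  (RingCon.eq _).trans ((TwoSidedIdeal.rel_iff _ _ _).trans (mem_nullIdeal ω X))

instance : SMul ℂ (TracialUltrapower ω X) where
  smul c := Quotient.map' (c • ·) fun x y h => by
    have h' := (mk_eq_mk ω X).mp (Quotient.sound h : mk ω X x = mk ω X y)
    refine Quotient.exact ((mk_eq_mk ω X).mpr ?_ : mk ω X (c • x) = mk ω X (c • y))
    have e : ∀ n, uniformTwoNorm X ((c • x) n - (c • y) n)
        = ‖c‖ * uniformTwoNorm X (x n - y n) := fun n => by
      rw [← uniformTwoNorm_smul, smul_sub]; rfl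
    simpa only [e, mul_zero] using h'.const_mul ‖c‖

theorem mk_smul (c : ℂ) (x : ℓ^∞(ℕ, B)) : mk ω X (c • x) = c • mk ω X x := rfl

instance : Module ℂ (TracialUltrapower ω X) :=
  Function.Surjective.module ℂ (mk ω X : ℓ^∞(ℕ, B) →+ TracialUltrapower ω X)
    (mk_surjective ω X) (mk_smul ω X)

instance : IsScalarTower ℂ (TracialUltrapower ω X) (TracialUltrapower ω X) where
  smul_assoc c x y := by
    obtain ⟨x, rfl⟩ := mk_surjective ω X x
    obtain ⟨y, rfl⟩ := mk_surjective ω X y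
    simp only [smul_eq_mul, ← mk_smul, ← map_mul, smul_mul_assoc]

instance : SMulCommClass ℂ (TracialUltrapower ω X) (TracialUltrapower ω X) where
  smul_comm c x y := by
    obtain ⟨x, rfl⟩ := mk_surjective ω X x
    obtain ⟨y, rfl⟩ := mk_surjective ω X y
    simp only [smul_eq_mul, ← mk_smul, ← map_mul, mul_smul_comm]

instance : Star (TracialUltrapower ω X) where
  star := Quotient.map' star fun x y h => by
    have h' := (mk_eq_mk ω X).mp (Quotient.sound h : mk ω X x = mk ω X y)
    refine Quotient.exact ((mk_eq_mk ω X).mpr ?_ : mk ω X (star x) = mk ω X (star y))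
    have e : ∀ n, uniformTwoNorm X ((star x) n - (star y) n)
        = uniformTwoNorm X (x n - y n) := fun n => by
      rw [← uniformTwoNorm_star, star_sub]; simp
    simpa only [e] using h'

theorem mk_star (x : ℓ^∞(ℕ, B)) : mk ω X (star x) = star (mk ω X x) := rfl

instance : StarRing (TracialUltrapower ω X) where
  star_involutive x := by
    obtain ⟨x, rfl⟩ := mk_surjective ω X x
    simp only [← mk_star, star_star]
  star_mul x y := by
    obtain ⟨x, rfl⟩ := mk_surjective ω X x
    obtain ⟨y, rfl⟩ := mk_surjective ω X y
    simp only [← map_mul, ← mk_star, star_mul]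
  star_add x y := by
    obtain ⟨x, rfl⟩ := mk_surjective ω X x
    obtain ⟨y, rfl⟩ := mk_surjective ω X y
    simp only [← map_add, ← mk_star, star_add]

instance : StarModule ℂ (TracialUltrapower ω X) where
  star_smul c x := by
    obtain ⟨x, rfl⟩ := mk_surjective ω X x
    simp only [← mk_star, ← mk_smul, star_smul]

/-- The canonical map `ι` from `B` to the ultrapower, through constant sequences. -/
def incl (b : B) : TracialUltrapower ω X :=
  mk ω X ⟨fun _ => b, memℓp_infty ⟨‖b‖, by rintro _ ⟨_, rfl⟩; exact le_rfl⟩⟩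

end TracialUltrapower

/-- `e` is the unit of the (a priori non-unital) ring `R`. -/
def IsUnitElement {R : Type u} [NonUnitalRing R] (e : R) : Prop := ∀ x, e * x = x ∧ x * e = x

/-- The full matrix algebra `M_n` embeds unitally into the relative commutant in the ultrapower
of a set `S ⊆ B` (regarded as constant sequences): there is an injective `⋆`-homomorphism
with values in this commutant that sends the identity matrix to the unit of the ultrapower. -/
def MatrixEmbedsCentrally (S : Set B) (n : ℕ) : Prop :=
  ∃ φ : Matrix (Fin n) (Fin n) ℂ →⋆ₙₐ[ℂ] TracialUltrapower ω X,
    Function.Injective φ ∧ IsUnitElement (φ 1) ∧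
      ∀ m, φ m ∈ Set.centralizer (TracialUltrapower.incl ω X '' S)

end Ultrapower

/-! ### The uniform tracial ultrapower, CPoU and the uniform McDuff property -/

section Uniform

variable (ω : Ultrafilter ℕ) (A : Type u) [NonUnitalCStarAlgebra A]

/-- The uniform tracial ultrapower `A^ω`, formed with respect to `‖·‖_{2,T(A)}`. -/
abbrev UniformUltrapower : Type u := TracialUltrapower ω (Set.univ : Set (traceSpace A))

variable {A}

theorem exists_tendsto_trace (τ : ℕ → traceSpace A) (x : ℓ^∞(ℕ, A)) :
    ∃ c : ℂ, Tendsto (fun n => (τ n).1 (x n)) ω (𝓝 c) := by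
  obtain ⟨c, -, hc⟩ := (isCompact_closedBall (0 : ℂ) ‖x‖).ultrafilter_le_nhds
    (ω.map fun n => (τ n).1 (x n)) (by
      refine le_principal_iff.mpr (Filter.mem_map.mpr (Filter.univ_mem' fun n => ?_))
      simpa using (norm_trace_le (τ n) (x n)).trans (lp.norm_apply_le_norm (by simp) x n))
  exact ⟨c, hc⟩

theorem tendsto_limUnder_trace (τ : ℕ → traceSpace A) (x : ℓ^∞(ℕ, A)) :
    Tendsto (fun n => (τ n).1 (x n)) ω (𝓝 (limUnder ω fun n => (τ n).1 (x n))) :=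
  tendsto_nhds_limUnder (exists_tendsto_trace ω τ x)

/-- The limit trace on `A^ω` given on representatives by `(xₙ) ↦ lim_{n → ω} τₙ(xₙ)`. -/
def limitTrace (τ : ℕ → traceSpace A) : UniformUltrapower ω A →ₗ[ℂ] ℂ where
  toFun := Quotient.lift (fun x : ℓ^∞(ℕ, A) => limUnder ω fun n => (τ n).1 (x n)) (by
    intro x y h
    have h' := (TracialUltrapower.mk_eq_mk ω _).mp (Quotient.sound h :
      TracialUltrapower.mk ω (Set.univ : Set (traceSpace A)) x = TracialUltrapower.mk ω _ y)
    have hd : Tendsto (fun n => (τ n).1 (x n) - (τ n).1 (y n)) ω (𝓝 0) := by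
      refine squeeze_zero_norm (fun n => ?_) h'
      rw [← map_sub]
      exact (norm_trace_le_twoNorm _ _).trans (twoNorm_le_uniform (Set.mem_univ _) _)
    exact sub_eq_zero.mp (tendsto_nhds_unique
      ((tendsto_limUnder_trace ω τ x).sub (tendsto_limUnder_trace ω τ y)) hd))
  map_add' x y := by
    obtain ⟨x, rfl⟩ := TracialUltrapower.mk_surjective ω _ x
    obtain ⟨y, rfl⟩ := TracialUltrapower.mk_surjective ω _ y
    refine tendsto_nhds_unique (tendsto_limUnder_trace ω τ (x + y)) ?_
    simpa using! (tendsto_limUnder_trace ω τ x).add (tendsto_limUnder_trace ω τ y)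
  map_smul' c x := by
    obtain ⟨x, rfl⟩ := TracialUltrapower.mk_surjective ω _ x
    refine tendsto_nhds_unique (tendsto_limUnder_trace ω τ (c • x)) ?_
    simpa using! (tendsto_limUnder_trace ω τ x).const_mul c

theorem tendsto_limitTrace (τ : ℕ → traceSpace A) (x : ℓ^∞(ℕ, A)) :
    Tendsto (fun n => (τ n).1 (x n)) ω
      (𝓝 (limitTrace ω τ (TracialUltrapower.mk ω Set.univ x))) :=
  tendsto_limUnder_trace ω τ x

variable (A)

/-- `T_ω(A)`: the limit traces on `A^ω`. -/
def limitTraces : Set (UniformUltrapower ω A →ₗ[ℂ] ℂ) := Set.range (limitTrace ω)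

/-- `A` has complemented partitions of unity (CPoU). Positive elements of `A^ω` are those of the
form `b⋆b`. -/
def HasCPoU : Prop :=
  ∀ (k : ℕ), 1 ≤ k → ∀ a : Fin k → UniformUltrapower ω A, (∀ i, ∃ b, a i = star b * b) →
    ∀ δ : ℝ, (⨆ τ : limitTraces ω A, ⨅ i, (τ.1 (a i)).re) < δ →
      ∃ p : Fin k → UniformUltrapower ω A,
        (∀ i, IsStarProjection (p i)) ∧
        (∀ i j, i ≠ j → p i * p j = 0) ∧
        (∀ i, p i ∈ Set.centralizer (Set.range (TracialUltrapower.incl ω Set.univ))) ∧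
        IsUnitElement (∑ i, p i) ∧
        ∀ i, ∀ τ ∈ limitTraces ω A, (τ (p i * a i)).re ≤ δ * (τ (p i)).re

/-- `A` is uniformly McDuff: every `M_n` embeds unitally into `A^ω ∩ A'`. -/
def IsUniformlyMcDuff : Prop :=
  ∀ n : ℕ, 1 ≤ n → MatrixEmbedsCentrally ω (Set.univ : Set (traceSpace A)) Set.univ n

end Uniform

/-! ### The von Neumann algebra `π_τ(A)''` and its canonical trace -/

section GNS

variable {A : Type u} [NonUnitalCStarAlgebra A] [PartialOrder A] [StarOrderedRing A]
variable (τ : traceSpace A)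

/-- The GNS Hilbert space of `τ`. -/
abbrev GNSSpace : Type u := (toPositive τ).GNS

/-- The GNS representation `π_τ`. -/
abbrev gnsRep : A →⋆ₙₐ[ℂ] (GNSSpace τ →L[ℂ] GNSSpace τ) := (toPositive τ).gnsNonUnitalStarAlgHom

theorem gnsRep_coe (a : A) (b : (toPositive τ).PreGNS) :
    gnsRep τ a (b : GNSSpace τ) =
      (((toPositive τ).toPreGNS (a * (toPositive τ).ofPreGNS b) : (toPositive τ).PreGNS) :
        GNSSpace τ) := by
  simp

theorem range_union_star :
    Set.range (gnsRep τ) ∪ star (Set.range (gnsRep τ)) = Set.range (gnsRep τ) := by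
  refine Set.union_eq_self_of_subset_right ?_
  rintro x ⟨a, ha⟩
  exact ⟨star a, by rw [map_star, ha, star_star]⟩

/-- The von Neumann algebra `π_τ(A)''`, the bicommutant of the image of the GNS representation. -/
def gnsVN : VonNeumannAlgebra (GNSSpace τ) where
  toStarSubalgebra := StarSubalgebra.centralizer ℂ
    (StarSubalgebra.centralizer ℂ (Set.range (gnsRep τ)) : Set (GNSSpace τ →L[ℂ] GNSSpace τ))
  centralizer_centralizer' := by
    change Set.centralizer (Set.centralizer ((StarSubalgebra.centralizer ℂ
      (StarSubalgebra.centralizer ℂ (Set.range (gnsRep τ)) : Set (GNSSpace τ →L[ℂ] GNSSpace τ)) :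
        StarSubalgebra ℂ (GNSSpace τ →L[ℂ] GNSSpace τ)) : Set (GNSSpace τ →L[ℂ] GNSSpace τ))) =
      ((StarSubalgebra.centralizer ℂ
      (StarSubalgebra.centralizer ℂ (Set.range (gnsRep τ)) : Set (GNSSpace τ →L[ℂ] GNSSpace τ)) :
        StarSubalgebra ℂ (GNSSpace τ →L[ℂ] GNSSpace τ)) : Set (GNSSpace τ →L[ℂ] GNSSpace τ))
    rw [StarSubalgebra.coe_centralizer_centralizer, Set.centralizer_centralizer_centralizer]

theorem coe_gnsVN : (gnsVN τ : Set (GNSSpace τ →L[ℂ] GNSSpace τ)) =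
    Set.centralizer (Set.centralizer (Set.range (gnsRep τ))) := by
  have h := StarSubalgebra.coe_centralizer_centralizer ℂ (Set.range (gnsRep τ))
  rw [range_union_star] at h
  exact h

instance : IsClosed ((gnsVN τ).toStarSubalgebra : Set (GNSSpace τ →L[ℂ] GNSSpace τ)) := by
  rw [VonNeumannAlgebra.coe_toStarSubalgebra, coe_gnsVN]
  exact Set.isClosed_centralizer _

/-- `π_τ(A)''` as a type; it is a `C⋆`-algebra as a norm closed subalgebra of `B(H_τ)`. -/
abbrev GNSBicommutant : Type u := (gnsVN τ).toStarSubalgebra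

theorem gnsRep_mem (a : A) : gnsRep τ a ∈ (gnsVN τ).toStarSubalgebra := by
  rw [← SetLike.mem_coe, VonNeumannAlgebra.coe_toStarSubalgebra, coe_gnsVN]
  exact Set.subset_centralizer_centralizer ⟨a, rfl⟩

/-- The GNS representation with values in `π_τ(A)''`. -/
def toGNSBicommutant (a : A) : GNSBicommutant τ := ⟨gnsRep τ a, gnsRep_mem τ a⟩

/-- The functional `[a] ↦ τ(a)` on the GNS Hilbert space. -/
def gnsDualVector : StrongDual ℂ (GNSSpace τ) :=
  LinearMap.extendOfNorm ((toPositive τ).toLinearMap ∘ₗ (toPositive τ).ofPreGNS.toLinearMap)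
    (UniformSpace.Completion.toComplL (𝕜 := ℂ) (E := (toPositive τ).PreGNS)).toLinearMap

theorem norm_toPositive_le (b : (toPositive τ).PreGNS) :
    ‖toPositive τ ((toPositive τ).ofPreGNS b)‖ ≤ 1 * ‖(b : GNSSpace τ)‖ := by
  rw [one_mul, UniformSpace.Completion.norm_coe]
  exact norm_trace_le_twoNorm τ _

theorem gnsDualVector_coe (b : (toPositive τ).PreGNS) :
    gnsDualVector τ (b : GNSSpace τ) = toPositive τ ((toPositive τ).ofPreGNS b) :=
  LinearMap.extendOfNorm_eq (UniformSpace.Completion.denseRange_coe)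
    ⟨1, norm_toPositive_le τ⟩ b

/-- The canonical cyclic vector `ξ_τ` of the GNS representation, determined by
`⟪ξ_τ, [a]⟫ = τ(a)`, equivalently by `π_τ(a) ξ_τ = [a]`. -/
def gnsVector : GNSSpace τ := (InnerProductSpace.toDual ℂ (GNSSpace τ)).symm (gnsDualVector τ)

theorem inner_gnsVector (b : (toPositive τ).PreGNS) :
    ⟪gnsVector τ, (b : GNSSpace τ)⟫_ℂ = τ.1 ((toPositive τ).ofPreGNS b) := by
  rw [gnsVector, InnerProductSpace.toDual_symm_apply, gnsDualVector_coe]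
  rfl

theorem ext_inner_coe {x y : GNSSpace τ}
    (h : ∀ b : (toPositive τ).PreGNS, ⟪x, (b : GNSSpace τ)⟫_ℂ = ⟪y, (b : GNSSpace τ)⟫_ℂ) :
    x = y := by
  refine ext_inner_right ℂ fun v => ?_
  induction v using UniformSpace.Completion.induction_on with
  | hp => exact isClosed_eq (by fun_prop) (by fun_prop)
  | ih b => exact h b

theorem inner_coe (a b : (toPositive τ).PreGNS) : ⟪(a : GNSSpace τ), (b : GNSSpace τ)⟫_ℂ =
    τ.1 (star ((toPositive τ).ofPreGNS a) * (toPositive τ).ofPreGNS b) := by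
  rw [UniformSpace.Completion.inner_coe]
  rfl

theorem gnsRep_gnsVector (a : A) :
    gnsRep τ a (gnsVector τ) = ((toPositive τ).toPreGNS a : (toPositive τ).PreGNS) := by
  refine ext_inner_coe τ fun b => ?_
  rw [← ContinuousLinearMap.adjoint_inner_right, ← ContinuousLinearMap.star_eq_adjoint,
    ← map_star, gnsRep_coe, inner_gnsVector, inner_coe]
  simp

theorem norm_gnsVector : ‖gnsVector τ‖ = 1 := by
  refine le_antisymm ?_ ?_
  · rw [gnsVector, LinearIsometryEquiv.norm_map]
    exact LinearMap.opNorm_extendOfNorm_le UniformSpace.Completion.denseRange_coe zero_le_one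
      (norm_toPositive_le τ)
  · rw [← τ.2.2.1]
    refine ContinuousLinearMap.opNorm_le_bound _ (norm_nonneg _) fun a => ?_
    have h := norm_inner_le_norm (𝕜 := ℂ) (gnsVector τ)
      (((toPositive τ).toPreGNS a : (toPositive τ).PreGNS) : GNSSpace τ)
    rw [inner_gnsVector, UniformSpace.Completion.norm_coe, ← twoNorm_eq_norm] at h
    exact h.trans (mul_le_mul_of_nonneg_left (twoNorm_le τ a) (norm_nonneg _))

/-- Right multiplication by `a` on the GNS Hilbert space. -/
def rightMul (a : A) : GNSSpace τ →L[ℂ] GNSSpace τ :=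
  (LinearMap.mkContinuous
    ((toPositive τ).toPreGNS.toLinearMap ∘ₗ (LinearMap.mulRight ℂ a) ∘ₗ
      (toPositive τ).ofPreGNS.toLinearMap) ‖a‖
    fun b => twoNorm_mul_le_right τ ((toPositive τ).ofPreGNS b) a).completion

theorem rightMul_coe (a : A) (b : (toPositive τ).PreGNS) :
    rightMul τ a (b : GNSSpace τ) =
      (((toPositive τ).toPreGNS ((toPositive τ).ofPreGNS b * a) : (toPositive τ).PreGNS) :
        GNSSpace τ) := by
  simp only [rightMul, ContinuousLinearMap.completion_apply_coe]
  rfl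

theorem inner_rightMul (a : A) (x y : GNSSpace τ) :
    ⟪rightMul τ a x, y⟫_ℂ = ⟪x, rightMul τ (star a) y⟫_ℂ := by
  induction x, y using UniformSpace.Completion.induction_on₂ with
  | hp => exact isClosed_eq (by fun_prop) (by fun_prop)
  | ih x y =>
    rw [rightMul_coe, rightMul_coe, inner_coe, inner_coe]
    simp [τ.2.2.2 (star a), mul_assoc]

theorem rightMul_gnsVector (a : A) :
    rightMul τ a (gnsVector τ) = ((toPositive τ).toPreGNS a : (toPositive τ).PreGNS) := by
  refine ext_inner_coe τ fun b => ?_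
  rw [inner_rightMul, rightMul_coe, inner_gnsVector, inner_coe]
  simp [τ.2.2.2 (star a)]

theorem rightMul_mem (a : A) : rightMul τ a ∈ Set.centralizer (Set.range (gnsRep τ)) := by
  rintro _ ⟨b, rfl⟩
  ext x
  induction x using UniformSpace.Completion.induction_on with
  | hp => exact isClosed_eq (by fun_prop) (by fun_prop)
  | ih x =>
    simp only [mul_apply_eq_comp, gnsRep_coe, rightMul_coe]
    simp [mul_assoc]

theorem commute_rightMul (x : GNSBicommutant τ) (a : A) (v : GNSSpace τ) :
    x.1 (rightMul τ a v) = rightMul τ a (x.1 v) := by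
  have hx : x.1 ∈ (gnsVN τ : Set (GNSSpace τ →L[ℂ] GNSSpace τ)) := x.2
  rw [coe_gnsVN] at hx
  exact (DFunLike.congr_fun (hx _ (rightMul_mem τ a)) v).symm

/-- The conjugation `[a] ↦ [a⋆]` on the GNS Hilbert space. -/
def conjugation : GNSSpace τ → GNSSpace τ :=
  UniformSpace.Completion.map fun b : (toPositive τ).PreGNS =>
    (toPositive τ).toPreGNS (star ((toPositive τ).ofPreGNS b))

theorem uniformContinuous_star : UniformContinuous fun b : (toPositive τ).PreGNS =>
    (toPositive τ).toPreGNS (star ((toPositive τ).ofPreGNS b)) := by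
  refine (LipschitzWith.of_dist_le_mul (K := 1) fun x y => ?_).uniformContinuous
  rw [dist_eq_norm, dist_eq_norm, NNReal.coe_one, one_mul, ← map_sub, ← star_sub, ← map_sub]
  exact (twoNorm_star τ _).le

theorem continuous_conjugation : Continuous (conjugation τ) :=
  UniformSpace.Completion.continuous_map

theorem conjugation_coe (b : (toPositive τ).PreGNS) :
    conjugation τ (b : GNSSpace τ) =
      ((toPositive τ).toPreGNS (star ((toPositive τ).ofPreGNS b)) : (toPositive τ).PreGNS) :=
  UniformSpace.Completion.map_coe (uniformContinuous_star τ) b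

theorem inner_conjugation (x y : GNSSpace τ) :
    ⟪conjugation τ x, conjugation τ y⟫_ℂ = ⟪y, x⟫_ℂ := by
  have hc := continuous_conjugation τ
  induction x, y using UniformSpace.Completion.induction_on₂ with
  | hp => exact isClosed_eq (by fun_prop) (by fun_prop)
  | ih x y =>
    rw [conjugation_coe, conjugation_coe, inner_coe, inner_coe]
    simp [τ.2.2.2 ((toPositive τ).ofPreGNS x)]

theorem conjugation_conjugation (x : GNSSpace τ) : conjugation τ (conjugation τ x) = x := by
  have hc := continuous_conjugation τ
  induction x using UniformSpace.Completion.induction_on with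
  | hp => exact isClosed_eq (by fun_prop) (by fun_prop)
  | ih x => simp [conjugation_coe]

theorem conjugation_apply_gnsVector (x : GNSBicommutant τ) :
    conjugation τ (x.1 (gnsVector τ)) = (star x).1 (gnsVector τ) := by
  refine ext_inner_coe τ fun b => ?_
  obtain ⟨a, rfl⟩ := (toPositive τ).toPreGNS.surjective b
  have h1 : ⟪conjugation τ (x.1 (gnsVector τ)),
      (((toPositive τ).toPreGNS a : (toPositive τ).PreGNS) : GNSSpace τ)⟫_ℂ =
      ⟪conjugation τ (((toPositive τ).toPreGNS a : (toPositive τ).PreGNS) : GNSSpace τ),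
        x.1 (gnsVector τ)⟫_ℂ := by
    rw [← inner_conjugation, conjugation_conjugation]
  rw [h1, conjugation_coe]
  change _ = ⟪star x.1 (gnsVector τ), _⟫_ℂ
  rw [ContinuousLinearMap.star_eq_adjoint, ContinuousLinearMap.adjoint_inner_left,
    ← rightMul_gnsVector τ a, commute_rightMul]
  simp only [PositiveLinearMap.ofPreGNS_toPreGNS]
  rw [← rightMul_gnsVector τ (star a), inner_rightMul, star_star]

/-- The vector functional `x ↦ ⟪ξ_τ, x ξ_τ⟫` on `π_τ(A)''`. -/
def gnsVectorFunctional : StrongDual ℂ (GNSBicommutant τ) :=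
  ((innerSL ℂ (gnsVector τ)) ∘L (ContinuousLinearMap.apply ℂ (GNSSpace τ) (gnsVector τ))) ∘L
    (gnsVN τ).toStarSubalgebra.toSubalgebra.toSubmodule.subtypeL

theorem gnsVectorFunctional_apply (x : GNSBicommutant τ) :
    gnsVectorFunctional τ x = ⟪gnsVector τ, x.1 (gnsVector τ)⟫_ℂ := rfl

theorem gnsVectorFunctional_mul (x y : GNSBicommutant τ) : gnsVectorFunctional τ (x * y) =
    ⟪(star x).1 (gnsVector τ), y.1 (gnsVector τ)⟫_ℂ := by
  change ⟪gnsVector τ, x.1 (y.1 (gnsVector τ))⟫_ℂ = ⟪star x.1 (gnsVector τ), _⟫_ℂ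
  rw [ContinuousLinearMap.star_eq_adjoint, ContinuousLinearMap.adjoint_inner_left]

theorem gnsVectorFunctional_norm : ‖gnsVectorFunctional τ‖ = 1 := by
  refine le_antisymm ?_ ?_
  · refine ContinuousLinearMap.opNorm_le_bound _ zero_le_one fun x => ?_
    rw [gnsVectorFunctional_apply, one_mul]
    calc _ ≤ ‖gnsVector τ‖ * ‖x.1 (gnsVector τ)‖ := norm_inner_le_norm _ _
      _ ≤ ‖x.1‖ := by simpa [norm_gnsVector] using x.1.le_opNorm (gnsVector τ)
  · have h := (gnsVectorFunctional τ).le_opNorm 1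
    have h1 : gnsVectorFunctional τ 1 = 1 := by
      change ⟪gnsVector τ, gnsVector τ⟫_ℂ = 1
      rw [inner_self_eq_norm_sq_to_K, norm_gnsVector]
      simp
    have h2 : ‖(1 : GNSBicommutant τ)‖ ≤ 1 := ContinuousLinearMap.norm_id_le
    rw [h1, norm_one] at h
    exact h.trans (mul_le_of_le_one_right (norm_nonneg _) h2)

/-- The canonical trace `x ↦ ⟪ξ_τ, x ξ_τ⟫` on `π_τ(A)''` induced by `τ`. -/
def gnsTrace : traceSpace (GNSBicommutant τ) :=
  ⟨StrongDual.toWeakDual (gnsVectorFunctional τ), fun x => by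
      change 0 ≤ gnsVectorFunctional τ (star x * x)
      rw [gnsVectorFunctional_mul, star_star, inner_self_eq_norm_sq_to_K]
      simp only [Complex.coe_algebraMap, ← Complex.ofReal_pow]
      exact Complex.zero_le_real.mpr (sq_nonneg _),
    gnsVectorFunctional_norm τ, fun x y => by
      change gnsVectorFunctional τ (x * y) = gnsVectorFunctional τ (y * x)
      rw [gnsVectorFunctional_mul, gnsVectorFunctional_mul, ← conjugation_apply_gnsVector,
        ← star_star y, ← conjugation_apply_gnsVector, inner_conjugation, star_star]⟩

theorem gnsTrace_apply (x : GNSBicommutant τ) :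
    (gnsTrace τ).1 x = ⟪gnsVector τ, x.1 (gnsVector τ)⟫_ℂ := rfl

/-- The canonical trace on `π_τ(A)''` extends `τ`. -/
theorem gnsTrace_toGNSBicommutant (a : A) : (gnsTrace τ).1 (toGNSBicommutant τ a) = τ.1 a := by
  rw [gnsTrace_apply, toGNSBicommutant, gnsRep_gnsVector, inner_gnsVector]
  rfl

/-- `π_τ(A)''` is McDuff: every `M_n` embeds unitally into `(π_τ(A)'')^ω ∩ π_τ(A)'`, where
`(π_τ(A)'')^ω` is the tracial ultrapower with respect to the canonical trace. -/
def GNSIsMcDuff (ω : Ultrafilter ℕ) : Prop :=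
  ∀ n : ℕ, 1 ≤ n → MatrixEmbedsCentrally ω {gnsTrace τ} (Set.range (toGNSBicommutant τ)) n

end GNS

end UniformTracial

end

/-!
The proof glues matrix units that exist trace by trace into matrix units of `A^ω ∩ A'`.

Fix `n`, finitely many `g₁, …, g_N ∈ A` and a tolerance. For a trace `σ`, the McDuff property of
`π_σ(A)''` gives matrix units in its tracial ultrapower that commute with `π_σ(A)`; they are
approximated in `‖·‖_{2,σ}` by contractions `c_{ij}` of `A` that satisfy the matrix unit
relations, commute with the `g_s` and sum to the unit, all up to a small error
(`exists_approximate_matrixUnits`). The total error `totalDefect` is weak-⋆ continuous in `σ`, so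
by compactness finitely many systems `c^{(1)}, …, c^{(k)}` suffice for all traces
(`exists_finite_cover_totalDefect_lt`). Applied to the sums `a_l = ∑ t⋆t` over the defects `t` of
`c^{(l)}`, CPoU yields projections `p_l ∈ A^ω ∩ A'` with sum one. The map
`(b_l) ↦ ∑ p_l b_l` is a `⋆`-homomorphism, hence the glued elements `∑ p_l c^{(l)}_{ij}` have
defects `T = ∑ p_l t_l`, and `τ(T⋆T) = ∑ τ(p_l t_l⋆ t_l) ≤ ∑ τ(p_l a_l) ≤ δ` for every limit trace
(`limitTrace_glue_le`). Passing to representatives gives contractions in `A` with defects that are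
small in `‖·‖_{2,T(A)}` (`exists_uniform_approximate_matrixUnits`), and a diagonal sequence of
these, along a dense sequence of `A`, represents exact matrix units (`exists_matrixUnits`).

The norms have to be controlled when elements of `π_σ(A)''` are approximated by elements of `A`,
and when the glued elements are lifted to sequences in `A`. Both are done with the truncation
`F(a) = 2 a (1 + a⋆a)⁻¹`, a contraction that is determined by `F(a) (1 + a⋆a) = 2 a`. As
`‖d‖_{2,τ} ≤ ‖d (1 + x⋆x)‖_{2,τ}`, this equation determines `F(a)` also modulo `‖·‖_{2,τ}`-null
sequences. So if `a` is close in `‖·‖_{2,τ}` to a fixed partial isometry `x`, then so is `F(a)`,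
whatever the norm of `a` (`twoNorm_truncation_sub_le`); this takes the place of Kaplansky's density
theorem. Moreover `F` commutes with gluing, `F(∑ p_l a_l) = ∑ p_l F(a_l)`, so that the glued
elements have contractive lifts (`exists_contractive_lift_of_truncation`).
-/

open scoped ComplexOrder InnerProductSpace Topology lp ENNReal
open Filter

namespace UniformTracial

universe u

/-! ### The truncation `2 a (1 + a⋆a)⁻¹` and the 2-seminorm -/

section Truncation

variable {B : Type u} [NonUnitalCStarAlgebra B]

/-- The truncation `c = 2 a (1 + a⋆a)⁻¹`, written without a unit as `2 a - 2 a k` with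
`k = y (1 + y)⁻¹` and `y = a⋆a`. It is a contraction because `c⋆c = 4 (k - k²)`. -/
theorem exists_contraction_truncation (a : B) :
    ∃ c : B, c + c * (star a * a) = a + a ∧ ‖c‖ ≤ 1 := by
  let _ := CStarAlgebra.spectralOrder B
  let _ := CStarAlgebra.spectralOrderedRing B
  set y := star a * a with hy
  have hy0 : 0 ≤ y := star_mul_self_nonneg a
  have hsa : IsSelfAdjoint y := .star_mul_self a
  have hq : ∀ t ∈ quasispectrum ℝ y, 0 ≤ t := fun t ht => quasispectrum_nonneg_of_nonneg y hy0 t ht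
  have hc : ContinuousOn (fun t : ℝ => t / (1 + t)) (quasispectrum ℝ y) :=
    continuousOn_id.div (by fun_prop) fun t ht => by have := hq t ht; positivity
  set k := cfcₙ (fun t : ℝ => t / (1 + t)) y with hk
  have hksa : star k = k := (cfcₙ_predicate _ y : IsSelfAdjoint k)
  have hyid : cfcₙ (fun t : ℝ => t) y = y := cfcₙ_id' ℝ y
  have hky : k + k * y = y := by
    have h1 : k * y = cfcₙ (fun t : ℝ => t / (1 + t) * t) y := by
      rw [cfcₙ_mul _ _ y hc (by simp) (by fun_prop) rfl, hyid]
    have h2 : cfcₙ (fun t : ℝ => t / (1 + t) + t / (1 + t) * t) y = k + k * y := by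
      rw [h1, cfcₙ_add _ (fun t : ℝ => t / (1 + t) * t) y hc (by simp)
        (hc.mul continuousOn_id) (by simp)]
    rw [← h2]
    conv_rhs => rw [← hyid]
    refine cfcₙ_congr fun t ht => ?_
    have := hq t ht
    field_simp
  have hyk : k + y * k = y := by
    simpa [hksa, hsa.star_eq] using congrArg star hky
  refine ⟨a + a - (a + a) * k, ?_, ?_⟩
  · calc _ = (a + a) + (a + a) * (y - (k + k * y)) := by noncomm_ring
      _ = _ := by rw [hky]; simp
  · have h1 : star (a + a - (a + a) * k) * (a + a - (a + a) * k) = (4 : ℝ) • (k - k * k) := by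
      have e : star (a + a - (a + a) * k) * (a + a - (a + a) * k) =
          (4 : ℤ) • (y - k * y - y * k + k * (y * k)) := by
        simp only [star_sub, star_add, star_mul, hksa, hy]
        noncomm_ring
      rw [e, eq_sub_of_add_eq' hky, eq_sub_of_add_eq' hyk, mul_sub, eq_sub_of_add_eq' hky,
        ← Int.cast_smul_eq_zsmul ℝ]
      push_cast
      congr 1
      abel
    have h2 : cfcₙ (fun t : ℝ => 4 * (t / (1 + t) - t / (1 + t) * (t / (1 + t)))) y =
        (4 : ℝ) • (k - k * k) := by
      rw [cfcₙ_const_mul (4 : ℝ) (fun t : ℝ => t / (1 + t) - t / (1 + t) * (t / (1 + t))) y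
          (hc.sub (hc.mul hc)) (by simp),
        cfcₙ_sub _ (fun t : ℝ => t / (1 + t) * (t / (1 + t))) y hc (by simp) (hc.mul hc) (by simp),
        cfcₙ_mul _ _ y hc (by simp) hc (by simp)]
    have h3 : ‖(4 : ℝ) • (k - k * k)‖ ≤ 1 := by
      rw [← h2]
      refine norm_cfcₙ_le fun t ht => ?_
      have ht := hq t ht
      rw [Real.norm_eq_abs, abs_le]
      have : t / (1 + t) ≤ 1 := (div_le_one (by positivity)).mpr (by linarith)
      have : 0 ≤ t / (1 + t) := by positivity
      constructor
      · nlinarith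
      · nlinarith [sq_nonneg (2 * (t / (1 + t)) - 1)]
    rw [← h1, CStarRing.norm_star_mul_self] at h3
    nlinarith [norm_nonneg (a + a - (a + a) * k)]

/-- The element `P = c a⋆` is self-adjoint with `2 P = c c⋆ + P²`, so `‖P‖² ≤ 2 ‖P‖ + 1`. -/
theorem norm_mul_star_le {a c : B} (h : c + c * (star a * a) = a + a) (hc : ‖c‖ ≤ 1) :
    ‖c * star a‖ ≤ 3 := by
  have h2 : star c + star a * a * star c = star a + star a := by
    simpa [mul_assoc] using congrArg star h
  have e : c * star a + c * star a = c * star c + (c * star a) * star (c * star a) := by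
    rw [← mul_add, ← h2]; simp [mul_add, mul_assoc]
  -- The right-hand side of `e` is self-adjoint.
  have hs : star (c * star a) = c * star a := by
    have h3 := congrArg star e
    simp only [star_add, star_mul, star_star, mul_assoc] at h3 e ⊢
    rw [← e] at h3
    have h4 : (2 : ℂ) • (a * star c) = (2 : ℂ) • (c * star a) := by simpa [two_smul] using h3
    exact smul_right_injective B (two_ne_zero) h4
  rw [hs] at e
  have h5 : ‖c * star a‖ ^ 2 ≤ 2 * ‖c * star a‖ + 1 := by
    have : ‖c * star a‖ ^ 2 = ‖(c * star a) * (c * star a)‖ := by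
      rw [sq, ← CStarRing.norm_star_mul_self, hs]
    rw [this, eq_sub_of_add_eq' e.symm]
    refine (norm_sub_le _ _).trans (add_le_add ((norm_add_le _ _).trans (by linarith)) ?_)
    rw [CStarRing.norm_self_mul_star]
    exact mul_le_one₀ hc (norm_nonneg _) hc
  nlinarith [norm_nonneg (c * star a)]

variable (τ : traceSpace B)

theorem trace_star_mul_self_re_nonneg (a : B) : 0 ≤ (τ.1 (star a * a)).re :=
  (Complex.nonneg_iff.mp (τ.2.1 a)).1

theorem sq_twoNorm (a : B) : twoNorm τ a ^ 2 = (τ.1 (star a * a)).re :=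
  Real.sq_sqrt (trace_star_mul_self_re_nonneg τ a)

/-- Right multiplication by `1 + x⋆x` does not decrease the 2-seminorm. Hence an element `d` is
determined by `d (1 + x⋆x)` up to null elements. -/
theorem twoNorm_le_add_mul_star_mul_self (d x : B) :
    twoNorm τ d ≤ twoNorm τ (d + d * (star x * x)) := by
  rw [← twoNorm_star τ d, ← twoNorm_star τ (d + _)]
  refine Real.sqrt_le_sqrt ?_
  set e := star d with he
  have h : star (star (d + d * (star x * x))) * star (d + d * (star x * x)) =
      star e * e + star (x * e) * (x * e) + star (x * e) * (x * e) +
        star (star x * (x * e)) * (star x * (x * e)) := by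
    simp only [he, star_add, star_mul, star_star, mul_add, add_mul, mul_assoc]
    abel
  rw [h]
  simp only [map_add, Complex.add_re]
  linarith [trace_star_mul_self_re_nonneg τ (x * e),
    trace_star_mul_self_re_nonneg τ (star x * (x * e))]

theorem twoNorm_neg (a : B) : twoNorm τ (-a) = twoNorm τ a := by simp [twoNorm]

theorem twoNorm_sub_le (a b : B) : twoNorm τ (a - b) ≤ twoNorm τ a + twoNorm τ b := by
  rw [sub_eq_add_neg, ← twoNorm_neg τ b]
  exact twoNorm_add_le τ _ _

/-- The truncation `c` of `a` is close to `x` in the 2-seminorm if `a` is close to `x` and `x` is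
nearly a partial isometry. The bound does not involve the norm of `a`. -/
theorem twoNorm_truncation_sub_le {a c : B} (h : c + c * (star a * a) = a + a) (hc : ‖c‖ ≤ 1)
    (x : B) : twoNorm τ (c - x) ≤
      (5 + ‖x‖) * twoNorm τ (a - x) + twoNorm τ (x * star x * x - x) := by
  refine (twoNorm_le_add_mul_star_mul_self τ (c - x) x).trans ?_
  -- Every term on the right contains `a - x` or the partial isometry defect of `x`, next to factors
  -- that are bounded by `‖x‖` and universal constants.
  have e : (c - x) + (c - x) * (star x * x) = ((a - x) + (a - x)) - (c * star a) * (a - x)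
      - c * star (a - x) * x - (x * star x * x - x) := by
    have h' : a + a = c + c * (star a * a) := h.symm
    have e1 : (a - x) + (a - x) = c + c * (star a * a) - (x + x) := by rw [← h']; abel
    rw [e1]
    simp only [star_sub]
    noncomm_ring
  rw [e]
  refine (twoNorm_sub_le τ _ _).trans (add_le_add_left ?_ _)
  have h1 := twoNorm_add_le τ (a - x) (a - x)
  have h2 := (twoNorm_mul_le_left τ (c * star a) (a - x)).trans
    (mul_le_mul_of_nonneg_right (norm_mul_star_le h hc) (twoNorm_nonneg τ _))
  have h3 : twoNorm τ (c * star (a - x) * x) ≤ ‖x‖ * twoNorm τ (a - x) := by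
    refine (twoNorm_mul_le_right τ _ x).trans (mul_le_mul_of_nonneg_left ?_ (norm_nonneg _))
    refine (twoNorm_mul_le_left τ _ _).trans ?_
    rw [twoNorm_star]
    exact mul_le_of_le_one_left (twoNorm_nonneg _ _) hc
  have h4 := twoNorm_sub_le τ ((a - x) + (a - x)) ((c * star a) * (a - x))
  have h5 := twoNorm_sub_le τ ((a - x) + (a - x) - (c * star a) * (a - x))
    (c * star (a - x) * x)
  linarith

end Truncation

/-! ### The defects of a system of matrix units -/

section Relations

theorem IsUnitElement.eq {R : Type u} [NonUnitalRing R] {e f : R} (he : IsUnitElement e)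
    (hf : IsUnitElement f) : e = f := by
  rw [← (he f).1, (hf e).2]

variable {R S : Type*} [NonUnitalRing R] [StarRing R] [NonUnitalRing S] [StarRing S]

/-- The index set of the relations for an `n × n` system of matrix units that commutes with `N`
given elements: products, adjoints and commutators. -/
abbrev RelIndex (n N : ℕ) : Type :=
  (Fin n × Fin n × Fin n × Fin n) ⊕ (Fin n × Fin n) ⊕ (Fin n × Fin n × Fin N)

/-- The defects of the elements `c i j` in the relations `c i j * c k l = δ_{jk} c i l`,
`(c i j)⋆ = c j i` and `c i j * g s = g s * c i j`. The relation `∑ i, c i i = 1` is not among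
them, because `R` need not have a unit. -/
def matrixDefect {n N : ℕ} (g : Fin N → R) (c : Fin n → Fin n → R) : RelIndex n N → R
  | .inl (i, j, k, l) => c i j * c k l - if j = k then c i l else 0
  | .inr (.inl (i, j)) => star (c i j) - c j i
  | .inr (.inr (i, j, s)) => c i j * g s - g s * c i j

theorem map_matrixDefect {n N : ℕ} {F : Type*} [FunLike F R S] [NonUnitalRingHomClass F R S]
    [StarHomClass F R S] (f : F) (g : Fin N → R) (c : Fin n → Fin n → R) (r : RelIndex n N) :
    f (matrixDefect g c r) = matrixDefect (fun s => f (g s)) (fun i j => f (c i j)) r := by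
  rcases r with ⟨i, j, k, l⟩ | ⟨i, j⟩ | ⟨i, j, s⟩
  · simp only [matrixDefect, map_sub, map_mul]
    split_ifs <;> simp
  · simp [matrixDefect, map_star]
  · simp [matrixDefect]

theorem IsUnitElement.star_eq {e : R} (he : IsUnitElement e) : star e = e := by
  have h := (he (star e)).1
  have h' := congrArg Star.star (he (Star.star e)).1
  simp only [star_mul, star_star] at h'
  rw [← h, h']

end Relations

/-! ### Bounded sequences and lifts from tracial ultrapowers -/

section Sequences

variable {B : Type u} [NonUnitalCStarAlgebra B]

/-- A sequence with a uniform norm bound, as an element of `ℓ^∞(B)`. -/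
def boundedSeq (x : ℕ → B) {C : ℝ} (h : ∀ n, ‖x n‖ ≤ C) : ℓ^∞(ℕ, B) :=
  ⟨x, memℓp_infty ⟨C, by rintro _ ⟨n, rfl⟩; exact h n⟩⟩

@[simp] theorem boundedSeq_apply (x : ℕ → B) {C : ℝ} (h : ∀ n, ‖x n‖ ≤ C) (n : ℕ) :
    boundedSeq x h n = x n := rfl

/-- The `m`-th coordinate of a bounded sequence, as a `⋆`-homomorphism. -/
def evalHom (m : ℕ) : ℓ^∞(ℕ, B) →⋆ₙ+* B where
  toFun x := x m
  map_mul' _ _ := rfl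
  map_zero' := rfl
  map_add' _ _ := rfl
  map_star' _ := rfl

theorem evalHom_apply (m : ℕ) (x : ℓ^∞(ℕ, B)) : evalHom m x = x m := rfl

/-- The embedding by constant sequences, as a `⋆`-homomorphism. -/
def constHom : B →⋆ₙ+* ℓ^∞(ℕ, B) where
  toFun b := boundedSeq (fun _ => b) fun _ => le_refl ‖b‖
  map_mul' _ _ := rfl
  map_zero' := rfl
  map_add' _ _ := rfl
  map_star' _ := rfl

theorem ext_seq {x y : ℓ^∞(ℕ, B)} (h : ∀ m, x m = y m) : x = y := lp.ext (funext h)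

theorem exists_truncation_seq (x : ℓ^∞(ℕ, B)) :
    ∃ c : ℓ^∞(ℕ, B), c + c * (star x * x) = x + x ∧ ∀ m, ‖c m‖ ≤ 1 := by
  choose c hc hc1 using fun m => exists_contraction_truncation (x m)
  exact ⟨boundedSeq c hc1, ext_seq hc, hc1⟩

theorem exists_star_mul_self_eq_sum {ι : Type*} (s : Finset ι) (x : ι → B) :
    ∃ b, ∑ i ∈ s, star (x i) * x i = star b * b := by
  let _ := CStarAlgebra.spectralOrder B
  let _ := CStarAlgebra.spectralOrderedRing B
  exact CStarAlgebra.nonneg_iff_eq_star_mul_self.mp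
    (Finset.sum_nonneg fun i _ => star_mul_self_nonneg (x i))

variable (ω : Ultrafilter ℕ) (X : Set (traceSpace B))

namespace TracialUltrapower

/-- The quotient map `mk`, as a `⋆`-homomorphism. -/
noncomputable def mkHom : ℓ^∞(ℕ, B) →⋆ₙ+* TracialUltrapower ω X :=
  { mk ω X with map_star' := fun _ => rfl }

theorem mkHom_apply (x : ℓ^∞(ℕ, B)) : mkHom ω X x = mk ω X x := rfl

theorem mk_sum {ι : Type*} (s : Finset ι) (x : ι → ℓ^∞(ℕ, B)) :
    mk ω X (∑ i ∈ s, x i) = ∑ i ∈ s, mk ω X (x i) := map_sum (mk ω X) x s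

/-- The canonical map `incl`, as a `⋆`-homomorphism. -/
noncomputable def inclHom : B →⋆ₙ+* TracialUltrapower ω X := (mkHom ω X).comp constHom

theorem inclHom_apply (b : B) : inclHom ω X b = incl ω X b := rfl

theorem incl_eq_mk (b : B) : incl ω X b = mk ω X (constHom b) := rfl

theorem mk_eq_zero {x : ℓ^∞(ℕ, B)} :
    mk ω X x = 0 ↔ Tendsto (fun n => uniformTwoNorm X (x n)) ω (𝓝 0) := by
  rw [← map_zero (mk ω X), mk_eq_mk]
  simp

variable {ω X} in
theorem eq_zero_of_add_mul_star_mul_self {d z : TracialUltrapower ω X}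
    (h : d + d * (star z * z) = 0) : d = 0 := by
  obtain ⟨d, rfl⟩ := mk_surjective ω X d
  obtain ⟨z, rfl⟩ := mk_surjective ω X z
  rw [← mk_star, ← map_mul, ← map_mul, ← map_add, mk_eq_zero] at h
  rw [mk_eq_zero]
  refine squeeze_zero (fun m => uniformTwoNorm_nonneg _ _) (fun m => ?_) h
  exact Real.iSup_le (fun τ => (twoNorm_le_add_mul_star_mul_self _ _ (z m)).trans
    (twoNorm_le_uniform τ.2 _)) (uniformTwoNorm_nonneg _ _)

variable {ω X} in
/-- The equation `w (1 + z⋆z) = 2 z` forces `w` to be the class of the truncations of any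
representative of `z`. -/
theorem exists_contractive_lift_of_truncation {w z : TracialUltrapower ω X}
    (h : w + w * (star z * z) = z + z) :
    ∃ c : ℓ^∞(ℕ, B), mk ω X c = w ∧ ∀ m, ‖c m‖ ≤ 1 := by
  obtain ⟨x, rfl⟩ := mk_surjective ω X z
  obtain ⟨c, hc, hc1⟩ := exists_truncation_seq x
  refine ⟨c, ?_, hc1⟩
  have h' := congrArg (mk ω X) hc
  simp only [map_add, map_mul, mk_star] at h'
  refine sub_eq_zero.mp (eq_zero_of_add_mul_star_mul_self (z := mk ω X x) ?_)
  rw [sub_mul, sub_add_sub_comm, h, h', sub_self]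

variable {ω X} in
theorem exists_contractive_lift_of_isUnitElement {u : TracialUltrapower ω X}
    (hu : IsUnitElement u) : ∃ e : ℓ^∞(ℕ, B), mk ω X e = u ∧ ∀ m, ‖e m‖ ≤ 1 :=
  exists_contractive_lift_of_truncation (z := u) (by rw [hu.star_eq, (hu u).1, (hu u).1])

variable {ω X} in
theorem exists_star_mul_self_eq_sum {ι : Type*} (s : Finset ι) (x : ι → TracialUltrapower ω X) :
    ∃ b, ∑ i ∈ s, star (x i) * x i = star b * b := by
  choose y hy using fun i => mk_surjective ω X (x i)
  obtain ⟨b, hb⟩ := UniformTracial.exists_star_mul_self_eq_sum s y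
  refine ⟨mk ω X b, ?_⟩
  rw [← mk_star, ← map_mul, ← hb, map_sum]
  simp [mk_star, hy]

variable {ω X} in
/-- A representative of the unit acts as a unit uniformly on the unit ball of `B`: otherwise a
sequence of counterexamples would represent an element not fixed by the unit. -/
theorem eventually_uniformTwoNorm_sub_unit_mul_le {e : ℓ^∞(ℕ, B)} (he : IsUnitElement (mk ω X e))
    {ε : ℝ} (hε : 0 < ε) :
    ∀ᶠ m in ω, ∀ b : B, ‖b‖ ≤ 1 → uniformTwoNorm X (e m * b - b) ≤ ε := by
  by_contra hcon
  rw [← Ultrafilter.eventually_not] at hcon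
  have hex : ∀ m, ∃ b : B, ‖b‖ ≤ 1 ∧ ((¬ ∀ b : B, ‖b‖ ≤ 1 → uniformTwoNorm X (e m * b - b) ≤ ε) →
      ε < uniformTwoNorm X (e m * b - b)) := fun m => by
    by_cases hm : ∀ b : B, ‖b‖ ≤ 1 → uniformTwoNorm X (e m * b - b) ≤ ε
    · exact ⟨0, by simp, fun h => absurd hm h⟩
    · push Not at hm
      obtain ⟨b, hb, hb'⟩ := hm
      exact ⟨b, hb, fun _ => hb'⟩
  choose b hb hb' using hex
  have h := (he (mk ω X (boundedSeq b hb))).1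
  rw [← map_mul, mk_eq_mk] at h
  obtain ⟨m, hm, hm'⟩ := ((h.eventually (gt_mem_nhds hε)).and hcon).exists
  exact absurd hm (not_lt.mpr (hb' m hm').le)

end TracialUltrapower

end Sequences

/-! ### Limit traces -/

section LimitTraces

open TracialUltrapower

variable {A : Type u} [NonUnitalCStarAlgebra A] {ω : Ultrafilter ℕ}

theorem limitTrace_star_mul_self_re_nonneg (τ : ℕ → traceSpace A) (z : UniformUltrapower ω A) :
    0 ≤ (limitTrace ω τ (star z * z)).re := by
  obtain ⟨x, rfl⟩ := mk_surjective ω _ z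
  exact ge_of_tendsto ((Complex.continuous_re.tendsto _).comp
    (tendsto_limitTrace ω τ (star x * x)))
    (.of_forall fun m => trace_star_mul_self_re_nonneg (τ m) (x m))

/-- The unit has a contractive lift, so its trace is at most one. -/
theorem limitTrace_unit_re_le_one (τ : ℕ → traceSpace A) {u : UniformUltrapower ω A}
    (hu : IsUnitElement u) : (limitTrace ω τ u).re ≤ 1 := by
  obtain ⟨e, rfl, he⟩ := exists_contractive_lift_of_isUnitElement hu
  refine le_of_tendsto ((Complex.continuous_re.tendsto _).comp (tendsto_limitTrace ω τ e))
    (.of_forall fun m => ?_)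
  exact (Complex.re_le_norm _).trans ((norm_trace_le (τ m) (e m)).trans (he m))

/-- A bound on all limit traces of a class holds, up to any error, for all traces of almost all
coordinates of a representative: otherwise traces that violate it define a limit trace. -/
theorem eventually_trace_re_lt {y : ℓ^∞(ℕ, A)} {δ δ' : ℝ}
    (h : ∀ τ ∈ limitTraces ω A, (τ (mk ω _ y)).re ≤ δ) (hδ : δ < δ')
    (hT : (traceSpace A).Nonempty) :
    ∀ᶠ m in ω, ∀ σ : traceSpace A, (σ.1 (y m)).re < δ' := by
  by_contra hcon
  rw [← Ultrafilter.eventually_not] at hcon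
  have hex : ∀ m, ∃ σ : traceSpace A, (¬ ∀ σ : traceSpace A, (σ.1 (y m)).re < δ') →
      δ' ≤ (σ.1 (y m)).re := fun m => by
    by_cases hm : ∀ σ : traceSpace A, (σ.1 (y m)).re < δ'
    · exact ⟨⟨_, hT.some_mem⟩, fun h => absurd hm h⟩
    · push Not at hm
      exact hm.imp fun σ hσ _ => hσ
  choose τ hτ using hex
  have h1 := ge_of_tendsto ((Complex.continuous_re.tendsto _).comp (tendsto_limitTrace ω τ y))
    (hcon.mono hτ)
  exact absurd (h _ ⟨τ, rfl⟩) (not_le.mpr (hδ.trans_le h1))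

/-- By compactness of `T(A)`, a limit trace restricts to a tracial state on `A`. -/
theorem exists_limitTrace_incl_eq (hTc : IsCompact (traceSpace A)) (τ : ℕ → traceSpace A) :
    ∃ σ : traceSpace A, ∀ a, limitTrace ω τ (incl ω _ a) = σ.1 a := by
  have := isCompact_iff_compactSpace.mp hTc
  obtain ⟨σ, -, hσ⟩ := isCompact_univ.ultrafilter_le_nhds (ω.map τ) (by simp)
  refine ⟨σ, fun a => ?_⟩
  have h1 : Tendsto (fun m => (τ m).1 a) ω (𝓝 (σ.1 a)) :=
    ((WeakDual.eval_continuous a).comp continuous_subtype_val).tendsto σ |>.comp hσ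
  exact tendsto_nhds_unique (tendsto_limitTrace ω τ (constHom a)) h1

end LimitTraces

/-! ### Approximate matrix units for a single trace -/

section Approximation

open TracialUltrapower

variable {A B : Type u} [NonUnitalCStarAlgebra A] [NonUnitalCStarAlgebra B]

theorem uniformTwoNorm_singleton (τ : traceSpace B)
    (x : B) : uniformTwoNorm {τ} x = twoNorm τ x := by
  simp [uniformTwoNorm]

theorem matrixDefect_eq_zero {ω : Ultrafilter ℕ}
    {X : Set (traceSpace B)} {S : Set B} {n N : ℕ}
    (φ : Matrix (Fin n) (Fin n) ℂ →⋆ₙₐ[ℂ] TracialUltrapower ω X)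
    (hφ : ∀ m, φ m ∈ Set.centralizer (incl ω X '' S)) (g : Fin N → B) (hg : ∀ s, g s ∈ S)
    (r : RelIndex n N) :
    matrixDefect (fun s => incl ω X (g s)) (fun i j => φ (Matrix.single i j 1)) r = 0 := by
  rcases r with ⟨i, j, k, l⟩ | ⟨i, j⟩ | ⟨i, j, s⟩
  · simp only [matrixDefect, ← map_mul]
    split_ifs with h
    · subst h; simp
    · simp [Matrix.single_mul_single_of_ne, h]
  · simp only [matrixDefect, ← map_star]
    simp [Matrix.star_eq_conjTranspose, Matrix.conjTranspose_single]
  · simp only [matrixDefect]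
    exact sub_eq_zero.mpr (hφ _ _ ⟨g s, hg s, rfl⟩).symm

/-- Matrix units in the tracial ultrapower of `B` that commute with `π(A)` are approximated in
`‖·‖_{2,τ}` by images of elements `c i j` of `A`, if `π(A)` is dense for `‖·‖_{2,τ}`. Each `c i j`
is the truncation of some `a i j`, hence a contraction; `a` is kept because this relation is what
survives gluing. -/
theorem exists_approximate_matrixUnits {ω : Ultrafilter ℕ} (hω : (ω : Filter ℕ) ≤ cofinite)
    (τ : traceSpace B) {e : B} (he : IsUnitElement e) (π : A →⋆ₙ+* B) (hπ : ∀ a, ‖π a‖ ≤ ‖a‖)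
    (hd : ∀ (x : B) {ε : ℝ}, 0 < ε → ∃ a, twoNorm τ (π a - x) < ε) {n : ℕ}
    (h : MatrixEmbedsCentrally ω {τ} (Set.range π) n)
    {N : ℕ} (g : Fin N → A) {ε : ℝ} (hε : 0 < ε) :
    ∃ a c : Fin n → Fin n → A,
      (∀ i j, c i j + c i j * (star (a i j) * a i j) = a i j + a i j) ∧
      (∀ r, twoNorm τ (π (matrixDefect g c r)) < ε) ∧
      twoNorm τ (e - π (∑ i, c i i)) < ε := by
  obtain ⟨φ, -, hu, hφ⟩ := h
  choose x hx using fun i j => mk_surjective ω {τ} (φ (Matrix.single i j 1))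
  have hpi : ∀ i j, mk ω {τ} (x i j) * star (mk ω {τ} (x i j)) * mk ω {τ} (x i j) =
      mk ω {τ} (x i j) := by
    intro i j
    rw [hx, ← map_star, ← map_mul, ← map_mul]
    simp [Matrix.star_eq_conjTranspose, Matrix.conjTranspose_single]
  choose a ha using fun (m : ℕ) i j => hd (x i j m) (Nat.one_div_pos_of_nat (α := ℝ) (n := m))
  choose c hc hc1 using fun (m : ℕ) i j => exists_contraction_truncation (a m i j)
  let C : Fin n → Fin n → ℓ^∞(ℕ, B) := fun i j =>
    boundedSeq (fun m => π (c m i j)) (fun m => (hπ _).trans (hc1 m i j))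
  -- The truncations of the approximants still represent the given matrix units, since these are
  -- partial isometries.
  have hCx : ∀ i j, mk ω {τ} (C i j) = φ (Matrix.single i j 1) := by
    intro i j
    rw [← hx, mk_eq_mk]
    have h1 := hpi i j
    rw [← mk_star, ← map_mul, ← map_mul, mk_eq_mk] at h1
    have h2 : Tendsto (fun m : ℕ => 1 / ((m : ℝ) + 1)) ω (𝓝 0) :=
      tendsto_one_div_add_atTop_nhds_zero_nat.mono_left (hω.trans Nat.cofinite_eq_atTop.le)
    have h5 := (h2.const_mul (5 + ‖x i j‖)).add h1
    rw [mul_zero, add_zero] at h5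
    refine squeeze_zero (fun m => uniformTwoNorm_nonneg _ _) (fun m => ?_) h5
    simp only [uniformTwoNorm_singleton]
    have h3 : π (c m i j) + π (c m i j) * (star (π (a m i j)) * π (a m i j)) =
        π (a m i j) + π (a m i j) := by
      rw [← map_star, ← map_mul, ← map_mul, ← map_add, hc, map_add]
    refine (twoNorm_truncation_sub_le τ h3 ((hπ _).trans (hc1 m i j)) (x i j m)).trans ?_
    have h4 := lp.norm_apply_le_norm (by simp) (x i j) m
    exact add_le_add (mul_le_mul (by linarith) (ha m i j).le (twoNorm_nonneg _ _) (by positivity))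
      le_rfl
  have hrel : ∀ r, ∀ᶠ m in ω, twoNorm τ (π (matrixDefect g (c m) r)) < ε := by
    intro r
    have h1 := matrixDefect_eq_zero φ hφ (fun s => π (g s)) (fun s => ⟨g s, rfl⟩) r
    simp only [← hCx] at h1
    have h2 := map_matrixDefect (mkHom ω {τ}) (fun s => constHom (π (g s))) C r
    have h3 := (mk_eq_zero ω {τ}).mp (h2.trans h1)
    filter_upwards [h3.eventually (gt_mem_nhds hε)] with m hm
    rw [← evalHom_apply, map_matrixDefect, uniformTwoNorm_singleton] at hm
    rw [map_matrixDefect π g (c m) r]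
    exact hm
  have hunit : ∀ᶠ m in ω, twoNorm τ (e - π (∑ i, c m i i)) < ε := by
    have h1 : mk ω {τ} (constHom e) = φ 1 := by
      refine IsUnitElement.eq (fun z => ?_) hu
      obtain ⟨z, rfl⟩ := mk_surjective ω _ z
      rw [← map_mul, ← map_mul]
      exact ⟨congrArg _ (ext_seq fun m => (he (z m)).1),
        congrArg _ (ext_seq fun m => (he (z m)).2)⟩
    have h2 : φ 1 = ∑ i, φ (Matrix.single i i 1) := by
      rw [← map_sum]
      congr 1
      exact (Matrix.sum_single_one).symm
    rw [h2] at h1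
    simp only [← hCx] at h1
    rw [← mk_sum, mk_eq_mk] at h1
    filter_upwards [h1.eventually (gt_mem_nhds hε)] with m hm
    rw [uniformTwoNorm_singleton, ← evalHom_apply m (∑ i, C i i), map_sum] at hm
    rw [map_sum]
    exact hm
  obtain ⟨m, hm1, hm2⟩ := ((eventually_all.mpr hrel).and hunit).exists
  exact ⟨a m, c m, hc m, hm1, hm2⟩

/-- The square of `‖1 - s‖_{2,σ}`, written so that it makes sense without a unit in `A`. -/
noncomputable def unitDefectSq (σ : traceSpace A) (s : A) : ℝ :=
  1 - 2 * (σ.1 s).re + (σ.1 (star s * s)).re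

/-- The sum of the squares of the 2-seminorms of all defects of `c`, including that of
`∑ i, c i i = 1`. -/
noncomputable def totalDefect {n N : ℕ} (g : Fin N → A) (c : Fin n → Fin n → A)
    (σ : traceSpace A) : ℝ :=
  ∑ r, (σ.1 (star (matrixDefect g c r) * matrixDefect g c r)).re + unitDefectSq σ (∑ i, c i i)

theorem continuous_totalDefect {n N : ℕ} (g : Fin N → A) (c : Fin n → Fin n → A) :
    Continuous (totalDefect g c) := by
  have h : ∀ a : A, Continuous fun σ : traceSpace A => (σ.1 a).re := fun a =>
    Complex.continuous_re.comp ((WeakDual.eval_continuous a).comp continuous_subtype_val)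
  unfold totalDefect unitDefectSq
  exact (continuous_finsetSum _ fun r _ => h _).add
    ((continuous_const.sub (continuous_const.mul (h _))).add (h _))

end Approximation

/-! ### The GNS von Neumann algebra and compactness -/

section Local

open TracialUltrapower

variable {A : Type u} [NonUnitalCStarAlgebra A] [PartialOrder A] [StarOrderedRing A]
variable (σ : traceSpace A)

/-- The GNS representation with values in `π_σ(A)''`, as a `⋆`-homomorphism. -/
noncomputable def bicommutantHom : A →⋆ₙ+* GNSBicommutant σ where
  toFun := toGNSBicommutant σ
  map_mul' a b := Subtype.ext (map_mul (gnsRep σ) a b)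
  map_zero' := Subtype.ext (map_zero (gnsRep σ))
  map_add' a b := Subtype.ext (map_add (gnsRep σ) a b)
  map_star' a := Subtype.ext (map_star (gnsRep σ) a)

theorem bicommutantHom_apply (a : A) : bicommutantHom σ a = toGNSBicommutant σ a := rfl

theorem norm_bicommutantHom_le (a : A) : ‖bicommutantHom σ a‖ ≤ ‖a‖ :=
  NonUnitalStarAlgHom.norm_apply_le (gnsRep σ) a

theorem twoNorm_bicommutantHom (a : A) :
    twoNorm (gnsTrace σ) (bicommutantHom σ a) = twoNorm σ a := by
  rw [twoNorm, ← map_star, ← map_mul, bicommutantHom_apply, gnsTrace_toGNSBicommutant, twoNorm]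

theorem twoNorm_gnsTrace (x : GNSBicommutant σ) :
    twoNorm (gnsTrace σ) x = ‖x.1 (gnsVector σ)‖ := by
  have h : (gnsTrace σ).1 (star x * x) = ⟪x.1 (gnsVector σ), x.1 (gnsVector σ)⟫_ℂ := by
    change gnsVectorFunctional σ (star x * x) = _
    rw [gnsVectorFunctional_mul, star_star]
  rw [twoNorm, h, inner_self_eq_norm_sq_to_K]
  simp only [Complex.coe_algebraMap, ← Complex.ofReal_pow, Complex.ofReal_re]
  exact Real.sqrt_sq (norm_nonneg _)

/-- The vectors `π_σ(a) ξ_σ = [a]` are dense in the GNS space, so `A` is dense in `π_σ(A)''` for the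
2-seminorm, without control of norms. -/
theorem exists_twoNorm_bicommutantHom_sub_lt (x : GNSBicommutant σ) {ε : ℝ} (hε : 0 < ε) :
    ∃ a : A, twoNorm (gnsTrace σ) (bicommutantHom σ a - x) < ε := by
  obtain ⟨b, hb⟩ := (UniformSpace.Completion.denseRange_coe
    (α := (toPositive σ).PreGNS)).exists_dist_lt (x.1 (gnsVector σ)) hε
  refine ⟨(toPositive σ).ofPreGNS b, ?_⟩
  rw [twoNorm_gnsTrace]
  change ‖gnsRep σ _ (gnsVector σ) - x.1 (gnsVector σ)‖ < ε
  rw [gnsRep_gnsVector, ← dist_eq_norm, dist_comm]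
  exact hb

theorem sq_twoNorm_one_sub (s : A) :
    twoNorm (gnsTrace σ) (1 - bicommutantHom σ s) ^ 2 = unitDefectSq σ s := by
  have h1 : (gnsTrace σ).1 1 = 1 := by
    rw [gnsTrace_apply]
    change ⟪gnsVector σ, gnsVector σ⟫_ℂ = 1
    rw [inner_self_eq_norm_sq_to_K, norm_gnsVector]
    simp
  have h2 : (σ.1 (star s)).re = (σ.1 s).re := by
    have : σ.1 (star s) = star (σ.1 s) := by
      exact map_star (toPositive σ) s
    rw [this]; simp
  rw [sq_twoNorm, unitDefectSq]
  have e : star (1 - bicommutantHom σ s) * (1 - bicommutantHom σ s) =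
      1 - bicommutantHom σ s - bicommutantHom σ (star s) + bicommutantHom σ (star s * s) := by
    rw [map_mul, map_star, star_sub, star_one]
    noncomm_ring
  rw [e]
  simp only [map_add, map_sub, bicommutantHom_apply, gnsTrace_toGNSBicommutant, h1,
    Complex.add_re, Complex.sub_re, Complex.one_re, h2]
  ring

theorem exists_totalDefect_lt {ω : Ultrafilter ℕ} (hω : (ω : Filter ℕ) ≤ cofinite) {n : ℕ}
    (h : MatrixEmbedsCentrally ω {gnsTrace σ} (Set.range (toGNSBicommutant σ)) n)
    {N : ℕ} (g : Fin N → A) {ε : ℝ} (hε : 0 < ε) :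
    ∃ a c : Fin n → Fin n → A,
      (∀ i j, c i j + c i j * (star (a i j) * a i j) = a i j + a i j) ∧
      totalDefect g c σ < ε := by
  set K : ℝ := Fintype.card (RelIndex n N) + 1 with hK
  have hK0 : 0 < K := by positivity
  obtain ⟨a, c, h1, h3, h4⟩ := exists_approximate_matrixUnits hω (gnsTrace σ)
    (e := 1) (fun x => ⟨one_mul x, mul_one x⟩) (bicommutantHom σ) (norm_bicommutantHom_le σ)
    (fun x _ => exists_twoNorm_bicommutantHom_sub_lt σ x) h g (Real.sqrt_pos.mpr (div_pos hε hK0))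
  simp only [twoNorm_bicommutantHom] at h3
  refine ⟨a, c, h1, ?_⟩
  have hsq : ∀ {t : ℝ}, 0 ≤ t → t < √(ε / K) → t ^ 2 < ε / K := fun ht h => by
    rw [← Real.sq_sqrt (div_pos hε hK0).le]
    exact pow_lt_pow_left₀ h ht two_ne_zero
  have h5 : unitDefectSq σ (∑ i, c i i) < ε / K := by
    rw [← sq_twoNorm_one_sub]
    exact hsq (twoNorm_nonneg _ _) h4
  have h6 : ∑ r, (σ.1 (star (matrixDefect g c r) * matrixDefect g c r)).re ≤
      Fintype.card (RelIndex n N) * (ε / K) := by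
    refine (Finset.sum_le_card_nsmul _ _ (ε / K) fun r _ => ?_).trans (by simp)
    rw [← sq_twoNorm]
    exact (hsq (twoNorm_nonneg _ _) (h3 r)).le
  calc totalDefect g c σ < Fintype.card (RelIndex n N) * (ε / K) + ε / K :=
        add_lt_add_of_le_of_lt h6 h5
    _ = K * (ε / K) := by rw [hK]; ring
    _ = ε := mul_div_cancel₀ _ hK0.ne'

theorem exists_finite_cover_totalDefect_lt {ω : Ultrafilter ℕ} (hω : (ω : Filter ℕ) ≤ cofinite)
    (hT : (traceSpace A).Nonempty) (hTc : IsCompact (traceSpace A)) {n : ℕ}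
    (h : ∀ σ : traceSpace A,
      MatrixEmbedsCentrally ω {gnsTrace σ} (Set.range (toGNSBicommutant σ)) n)
    {N : ℕ} (g : Fin N → A) {ε : ℝ} (hε : 0 < ε) :
    ∃ k : ℕ, 1 ≤ k ∧ ∃ a c : Fin k → Fin n → Fin n → A,
      (∀ l i j, c l i j + c l i j * (star (a l i j) * a l i j) = a l i j + a l i j) ∧
      ∀ σ, ∃ l, totalDefect g (c l) σ < ε := by
  have := isCompact_iff_compactSpace.mp hTc
  choose a c hac hc using fun σ => exists_totalDefect_lt σ hω (h σ) g hε
  obtain ⟨t, ht⟩ := CompactSpace.elim_nhds_subcover (fun σ => {σ' | totalDefect g (c σ) σ' < ε})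
    fun σ => (continuous_totalDefect g (c σ)).continuousAt.eventually_lt_const (hc σ)
  have hcov : ∀ σ, ∃ ρ ∈ t, totalDefect g (c ρ) σ < ε := fun σ => by
    have : σ ∈ ⋃ ρ ∈ t, {σ' | totalDefect g (c ρ) σ' < ε} := ht ▸ Set.mem_univ σ
    simpa using this
  refine ⟨t.card, ?_, fun l => a (t.equivFin.symm l), fun l => c (t.equivFin.symm l),
    fun l => hac _, fun σ => ?_⟩
  · obtain ⟨ρ, hρ, -⟩ := hcov ⟨_, hT.some_mem⟩
    exact Finset.card_pos.mpr ⟨ρ, hρ⟩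
  · obtain ⟨ρ, hρ, hlt⟩ := hcov σ
    exact ⟨t.equivFin ⟨ρ, hρ⟩, by simpa using hlt⟩

end Local

/-! ### Gluing along orthogonal projections -/

section Gluing

theorem matrixDefect_pi {S ι : Type*} [NonUnitalRing S] [StarRing S] {n N : ℕ}
    (g : Fin N → ι → S) (c : Fin n → Fin n → ι → S)
    (r : RelIndex n N) :
    matrixDefect g c r = fun l => matrixDefect (fun s => g s l) (fun i j => c i j l) r := by
  funext l
  rcases r with ⟨i, j, k, l⟩ | ⟨i, j⟩ | ⟨i, j, s⟩
  · simp only [matrixDefect, Pi.sub_apply, Pi.mul_apply]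
    split_ifs <;> rfl
  · rfl
  · rfl

variable {R S : Type*} [NonUnitalRing R] [StarRing R] [NonUnitalRing S] [StarRing S]
  {ι : Type*} [Fintype ι] {p : ι → R}

theorem sum_mul_mul_sum_mul (hp : ∀ i, IsStarProjection (p i)) (ho : ∀ i j, i ≠ j → p i * p j = 0)
    {x : ι → R} (hx : ∀ i, Commute (p i) (x i)) (y : ι → R) :
    (∑ i, p i * x i) * ∑ j, p j * y j = ∑ i, p i * (x i * y i) := by
  rw [Finset.sum_mul_sum]
  refine Finset.sum_congr rfl fun i _ => ?_
  rw [Finset.sum_eq_single i]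
  · rw [(hx i).eq, mul_assoc, ← mul_assoc (p i) (p i), (hp i).isIdempotentElem.eq, ← mul_assoc,
      ← (hx i).eq, mul_assoc]
  · intro j _ hj
    rw [(hx i).eq, mul_assoc, ← mul_assoc (p i) (p j), ho i j hj.symm, zero_mul, mul_zero]
  · simp

theorem star_sum_mul (hp : ∀ i, IsStarProjection (p i)) {x : ι → R}
    (hx : ∀ i, Commute (p i) (x i)) : star (∑ i, p i * x i) = ∑ i, p i * star (x i) := by
  rw [star_sum]
  refine Finset.sum_congr rfl fun i _ => ?_
  rw [(hx i).eq, star_mul, (hp i).isSelfAdjoint.star_eq]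

/-- Gluing `(x_i) ↦ ∑ p_i f(x_i)` along orthogonal projections that commute with the range of `f`,
as a `⋆`-homomorphism. -/
def glueHom (f : S →⋆ₙ+* R) (hp : ∀ i, IsStarProjection (p i))
    (ho : ∀ i j, i ≠ j → p i * p j = 0) (hf : ∀ i s, Commute (p i) (f s)) : (ι → S) →⋆ₙ+* R where
  toFun x := ∑ i, p i * f (x i)
  map_mul' x y := by
    simp [sum_mul_mul_sum_mul hp ho (fun i => hf i (x i)) fun i => f (y i)]
  map_zero' := by simp
  map_add' x y := by simp [mul_add, Finset.sum_add_distrib]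
  map_star' x := by simp [star_sum_mul hp (fun i => hf i (x i)), map_star]

end Gluing

/-! ### Complemented partitions of unity -/

section CPoU

open TracialUltrapower

variable {A : Type u} [NonUnitalCStarAlgebra A] {ω : Ultrafilter ℕ}

/-- The estimate that transfers CPoU to glued elements: if `τ(p_i ∑_o t_{io}⋆ t_{io}) ≤ δ τ(p_i)`
for all `i`, then each `T_o = ∑ p_i t_{io}` satisfies `τ(T_o⋆ T_o) ≤ δ`. -/
theorem limitTrace_glue_le {ι κ : Type*} [Fintype ι] [Fintype κ] {p : ι → UniformUltrapower ω A}
    (hp : ∀ i, IsStarProjection (p i)) (ho : ∀ i j, i ≠ j → p i * p j = 0)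
    (hu : IsUnitElement (∑ i, p i)) {t : ι → κ → UniformUltrapower ω A}
    (ht : ∀ i o, Commute (p i) (t i o)) (τ : ℕ → traceSpace A) {δ : ℝ} (hδ : 0 ≤ δ)
    (h : ∀ i, (limitTrace ω τ (p i * ∑ o, star (t i o) * t i o)).re ≤ δ * (limitTrace ω τ (p i)).re)
    (o : κ) :
    (limitTrace ω τ (star (∑ i, p i * t i o) * ∑ i, p i * t i o)).re ≤ δ := by
  have hs : ∀ i o, Commute (p i) (star (t i o)) := fun i o => by
    have := (ht i o).star_star
    rwa [(hp i).isSelfAdjoint.star_eq] at this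
  have hpos : ∀ i o, 0 ≤ (limitTrace ω τ (p i * (star (t i o) * t i o))).re := fun i o => by
    have e : star (t i o * p i) * (t i o * p i) = p i * (star (t i o) * t i o) := by
      rw [star_mul, (hp i).isSelfAdjoint.star_eq, ← (ht i o).eq, mul_assoc, ← mul_assoc _ (p i),
        ← (hs i o).eq, mul_assoc, ← mul_assoc, (hp i).isIdempotentElem.eq]
    rw [← e]
    exact limitTrace_star_mul_self_re_nonneg τ _
  rw [star_sum_mul hp (fun i => ht i o), sum_mul_mul_sum_mul hp ho (fun i => hs i o), map_sum,
    Complex.re_sum]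
  calc ∑ i, (limitTrace ω τ (p i * (star (t i o) * t i o))).re
      ≤ ∑ i, δ * (limitTrace ω τ (p i)).re := by
        refine Finset.sum_le_sum fun i _ => le_trans ?_ (h i)
        rw [Finset.mul_sum, map_sum, Complex.re_sum]
        exact Finset.single_le_sum (fun o _ => hpos i o) (Finset.mem_univ o)
    _ = δ * (limitTrace ω τ (∑ i, p i)).re := by
        rw [← Finset.mul_sum, map_sum, Complex.re_sum]
    _ ≤ δ := mul_le_of_le_one_right hδ (limitTrace_unit_re_le_one τ hu)

/-- CPoU with `k = 1` and `a_1 = 0` provides a unit of `A^ω`. -/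
theorem HasCPoU.exists_isUnitElement (h : HasCPoU ω A) :
    ∃ u : UniformUltrapower ω A, IsUnitElement u := by
  obtain ⟨p, -, -, -, hp, -⟩ := h 1 le_rfl (fun _ => 0) (fun _ => ⟨0, by simp⟩) 1 (by simp)
  exact ⟨_, hp⟩

theorem limitTrace_unit_sub_le (τ : ℕ → traceSpace A) {u : UniformUltrapower ω A}
    (hu : IsUnitElement u) {σ : traceSpace A}
    (hσ : ∀ a, limitTrace ω τ (incl ω _ a) = σ.1 a) (s : A) :
    (limitTrace ω τ (star (u - incl ω _ s) * (u - incl ω _ s))).re ≤ unitDefectSq σ s := by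
  let _ := CStarAlgebra.spectralOrder A
  let _ := CStarAlgebra.spectralOrderedRing A
  have h2 : (σ.1 (star s)).re = (σ.1 s).re := by
    have : σ.1 (star s) = star (σ.1 s) := map_star (toPositive σ) s
    rw [this]; simp
  have e : star (u - incl ω _ s) * (u - incl ω _ s) =
      u - incl ω _ s - incl ω _ (star s) + incl ω _ (star s * s) := by
    simp only [← inclHom_apply, map_mul, map_star, star_sub, sub_mul, mul_sub, hu.star_eq,
      (hu _).1, (hu _).2]
    abel
  rw [e, unitDefectSq]
  simp only [map_add, map_sub, hσ, Complex.add_re, Complex.sub_re, h2]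
  linarith [limitTrace_unit_re_le_one τ hu]

variable [PartialOrder A] [StarOrderedRing A]

theorem exists_glued_matrixUnits (hω : (ω : Filter ℕ) ≤ cofinite)
    (hT : (traceSpace A).Nonempty) (hTc : IsCompact (traceSpace A)) (hA : HasCPoU ω A) {n : ℕ}
    (h : ∀ σ : traceSpace A,
      MatrixEmbedsCentrally ω {gnsTrace σ} (Set.range (toGNSBicommutant σ)) n)
    {u : UniformUltrapower ω A} (hu : IsUnitElement u)
    {N : ℕ} (g : Fin N → A) {ε : ℝ} (hε : 0 < ε) :
    ∃ C : Fin n → Fin n → ℓ^∞(ℕ, A), (∀ i j m, ‖C i j m‖ ≤ 1) ∧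
      (∀ r, ∀ τ ∈ limitTraces ω A,
        (τ (star (matrixDefect (fun s => incl ω _ (g s)) (fun i j => mk ω _ (C i j)) r) *
          matrixDefect (fun s => incl ω _ (g s)) (fun i j => mk ω _ (C i j)) r)).re ≤ ε) ∧
      ∀ τ ∈ limitTraces ω A,
        (τ (star (u - ∑ i, mk ω _ (C i i)) * (u - ∑ i, mk ω _ (C i i)))).re ≤ ε := by
  obtain ⟨k, hk, a, c, hac, hcov⟩ :=
    exists_finite_cover_totalDefect_lt hω hT hTc h g (half_pos hε)
  let t : Fin k → Option (RelIndex n N) → UniformUltrapower ω A := fun l o =>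
    o.elim (u - incl ω _ (∑ i, c l i i)) fun r => incl ω _ (matrixDefect g (c l) r)
  have hle : ∀ τ : ℕ → traceSpace A, ∀ σ : traceSpace A,
      (∀ a, limitTrace ω τ (incl ω _ a) = σ.1 a) → ∀ l,
      (limitTrace ω τ (∑ o, star (t l o) * t l o)).re ≤ totalDefect g (c l) σ := by
    intro τ σ hσ l
    rw [Fintype.sum_option, add_comm, map_add, Complex.add_re, map_sum, Complex.re_sum]
    refine add_le_add (Finset.sum_le_sum fun r _ => ?_) (limitTrace_unit_sub_le τ hu hσ _)
    simp only [t, Option.elim_some]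
    rw [← hσ, ← inclHom_apply, ← inclHom_apply, map_mul (inclHom ω _), map_star (inclHom ω _)]
  obtain ⟨p, hp, ho, hpc, hp1, hpt⟩ := hA k hk (fun l => ∑ o, star (t l o) * t l o)
    (fun l => TracialUltrapower.exists_star_mul_self_eq_sum _ _) ε (by
      refine (Real.iSup_le ?_ (half_pos hε).le).trans_lt (half_lt_self hε)
      rintro ⟨_, τ, rfl⟩
      obtain ⟨σ, hσ⟩ := exists_limitTrace_incl_eq (ω := ω) hTc τ
      obtain ⟨l, hl⟩ := hcov σ
      exact (ciInf_le (Set.finite_range _).bddBelow l).trans ((hle τ σ hσ l).trans hl.le))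
  have hpi : ∀ l b, Commute (p l) (incl ω _ b) := fun l b => (hpc l _ ⟨b, rfl⟩).symm
  have hpu : ∀ l, Commute (p l) u := fun l => ((hu (p l)).2).trans ((hu (p l)).1).symm
  have ht : ∀ l o, Commute (p l) (t l o) := by
    rintro l (_ | r)
    · exact (hpu l).sub_right (hpi l _)
    · exact hpi l _
  have hbound : ∀ o, ∀ τ ∈ limitTraces ω A,
      (τ (star (∑ l, p l * t l o) * ∑ l, p l * t l o)).re ≤ ε := by
    rintro o _ ⟨τ, rfl⟩
    exact limitTrace_glue_le hp ho hp1 ht τ hε.le (fun l => hpt l _ ⟨τ, rfl⟩) o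
  let Γ : (Fin k → A) →⋆ₙ+* UniformUltrapower ω A := glueHom (inclHom ω _) hp ho hpi
  have hΓ : ∀ x, Γ x = ∑ l, p l * incl ω _ (x l) := fun _ => rfl
  -- Truncation commutes with gluing.
  have hlift : ∀ i j, ∃ C : ℓ^∞(ℕ, A), mk ω _ C = Γ (fun l => c l i j) ∧ ∀ m, ‖C m‖ ≤ 1 := by
    intro i j
    refine exists_contractive_lift_of_truncation (z := Γ fun l => a l i j) ?_
    rw [← map_star, ← map_mul, ← map_mul, ← map_add, ← map_add]
    exact congrArg Γ (funext fun l => hac l i j)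
  choose C hC hC1 using hlift
  refine ⟨C, hC1, fun r => ?_, ?_⟩
  · have hg : ∀ s, Γ (fun _ => g s) = incl ω _ (g s) := fun s => by
      rw [hΓ, ← Finset.sum_mul, (hp1 _).1]
    have e := map_matrixDefect Γ (fun s _ => g s) (fun i j l => c l i j) r
    simp only [hg, ← hC] at e
    rw [← e, matrixDefect_pi]
    exact hbound (some r)
  · have e : u - ∑ i, mk ω _ (C i i) = ∑ l, p l * t l none := by
      have e' : ∑ i, mk ω _ (C i i) = ∑ l, p l * incl ω _ (∑ i, c l i i) := by
        rw [Finset.sum_congr rfl fun i _ => hC i i, ← map_sum, hΓ]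
        simp only [Finset.sum_apply]
      simp only [e', t, Option.elim_none, mul_sub, Finset.sum_sub_distrib, ← Finset.sum_mul,
        (hp1 u).1]
    rw [e]
    exact hbound none

theorem exists_uniform_approximate_matrixUnits (hω : (ω : Filter ℕ) ≤ cofinite)
    (hT : (traceSpace A).Nonempty) (hTc : IsCompact (traceSpace A)) (hA : HasCPoU ω A) {n : ℕ}
    (h : ∀ σ : traceSpace A,
      MatrixEmbedsCentrally ω {gnsTrace σ} (Set.range (toGNSBicommutant σ)) n)
    {N : ℕ} (g : Fin N → A) {ε : ℝ} (hε : 0 < ε) :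
    ∃ c : Fin n → Fin n → A, (∀ i j, ‖c i j‖ ≤ 1) ∧
      (∀ r, uniformTwoNorm Set.univ (matrixDefect g c r) ≤ ε) ∧
      ∀ b, uniformTwoNorm Set.univ ((∑ i, c i i) * b - b) ≤ ε * ‖b‖ := by
  obtain ⟨u, hu⟩ := hA.exists_isUnitElement
  obtain ⟨e, rfl, he⟩ := exists_contractive_lift_of_isUnitElement hu
  have hε2 : 0 < ε / 2 := half_pos hε
  have hδ : 0 < (ε / 2) ^ 2 := by positivity
  obtain ⟨C, hC1, hCr, hCu⟩ := exists_glued_matrixUnits hω hT hTc hA h hu g (half_pos hδ)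
  have hev : ∀ y : ℓ^∞(ℕ, A),
      (∀ τ ∈ limitTraces ω A, (τ (star (mk ω _ y) * mk ω _ y)).re ≤ (ε / 2) ^ 2 / 2) →
      ∀ᶠ m in ω, uniformTwoNorm Set.univ (y m) ≤ ε / 2 := by
    intro y hy
    filter_upwards [eventually_trace_re_lt (y := star y * y) hy (half_lt_self hδ) hT] with m hm
    refine Real.iSup_le (fun σ => ?_) hε2.le
    refine (Real.sqrt_le_sqrt (hm σ.1).le).trans (Real.sqrt_sq hε2.le).le
  have h1 : ∀ r, ∀ᶠ m in ω,
      uniformTwoNorm Set.univ (matrixDefect g (fun i j => C i j m) r) ≤ ε / 2 := by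
    intro r
    have e1 := map_matrixDefect (mkHom ω Set.univ) (fun s => constHom (g s)) C r
    filter_upwards [hev (matrixDefect (fun s => constHom (g s)) C r) fun τ hτ => by
      rw [← mkHom_apply, e1]; exact hCr r τ hτ] with m hm
    rw [← evalHom_apply, map_matrixDefect] at hm
    exact hm
  have h2 : ∀ᶠ m in ω, uniformTwoNorm Set.univ (e m - ∑ i, C i i m) ≤ ε / 2 := by
    filter_upwards [hev (e - ∑ i, C i i) fun τ hτ => by
      rw [map_sub, mk_sum]; exact hCu τ hτ] with m hm
    rw [← evalHom_apply, map_sub, map_sum] at hm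
    exact hm
  obtain ⟨m, hm1, hm2, hm3⟩ := ((eventually_all.mpr h1).and
    (h2.and (eventually_uniformTwoNorm_sub_unit_mul_le hu hε2))).exists
  refine ⟨fun i j => C i j m, fun i j => hC1 i j m, fun r => (hm1 r).trans (by linarith), ?_⟩
  have hball : ∀ b : A, ‖b‖ ≤ 1 →
      uniformTwoNorm Set.univ ((∑ i, C i i m) * b - b) ≤ ε := fun b hb => by
    have e1 : (∑ i, C i i m) * b - b = (-1 : ℂ) • ((e m - ∑ i, C i i m) * b) + (e m * b - b) := by
      rw [neg_one_smul, sub_mul]; abel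
    rw [e1]
    refine (uniformTwoNorm_add_le _ _ _).trans ?_
    rw [uniformTwoNorm_smul, norm_neg, norm_one, one_mul]
    have := (uniformTwoNorm_mul_le_right Set.univ (e m - ∑ i, C i i m) b).trans
      (mul_le_of_le_one_left (uniformTwoNorm_nonneg _ _) hb)
    linarith [hm3 b hb]
  intro b
  rcases eq_or_ne b 0 with rfl | hb
  · simp [uniformTwoNorm_zero]
  have hb0 : 0 < ‖b‖ := norm_pos_iff.mpr hb
  have e1 : (∑ i, C i i m) * b - b = (‖b‖ : ℂ) • ((∑ i, C i i m) * ((‖b‖ : ℂ)⁻¹ • b) -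
      (‖b‖ : ℂ)⁻¹ • b) := by
    rw [mul_smul_comm, ← smul_sub, smul_smul, mul_inv_cancel₀ (by exact_mod_cast hb0.ne'), one_smul]
  rw [e1, uniformTwoNorm_smul, mul_comm ε, Complex.norm_real, norm_norm]
  refine mul_le_mul_of_nonneg_left (hball _ ?_) hb0.le
  rw [norm_smul, norm_inv, Complex.norm_real, norm_norm, inv_mul_cancel₀ hb0.ne']

end CPoU

/-! ### Exact matrix units -/

section MatrixUnits

variable {R : Type u} [NonUnitalRing R] [StarRing R] [Module ℂ R] [IsScalarTower ℂ R R]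
  [SMulCommClass ℂ R R] [StarModule ℂ R] {n : ℕ} {W : Fin n → Fin n → R}

/-- The `⋆`-homomorphism on the full matrix algebra defined by a system of matrix units. -/
def matrixUnitsHom (hmul : ∀ i j k l, W i j * W k l = if j = k then W i l else 0)
    (hstar : ∀ i j, star (W i j) = W j i) : Matrix (Fin n) (Fin n) ℂ →⋆ₙₐ[ℂ] R where
  toFun m := ∑ i, ∑ j, m i j • W i j
  map_smul' c m := by simp [Finset.smul_sum, smul_smul]
  map_zero' := by simp
  map_add' m m' := by simp [add_smul, Finset.sum_add_distrib]
  map_mul' m m' := by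
    rw [Finset.sum_mul]
    refine Finset.sum_congr rfl fun i _ => ?_
    simp only [Matrix.mul_apply, Finset.sum_smul]
    rw [Finset.sum_comm, Finset.sum_mul]
    refine Finset.sum_congr rfl fun j _ => ?_
    rw [Finset.mul_sum]
    refine .trans ?_ (Finset.sum_eq_single j (fun k _ hk => ?_) (by simp)).symm
    · simp [Finset.mul_sum, hmul, smul_mul_smul_comm]
    · simp [Finset.mul_sum, hmul, smul_mul_smul_comm, hk.symm]
  map_star' m := by
    simp only [star_sum, star_smul, hstar, Matrix.star_apply]
    exact Finset.sum_comm

theorem matrixUnitsHom_apply (hmul : ∀ i j k l, W i j * W k l = if j = k then W i l else 0)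
    (hstar : ∀ i j, star (W i j) = W j i) (m : Matrix (Fin n) (Fin n) ℂ) :
    matrixUnitsHom hmul hstar m = ∑ i, ∑ j, m i j • W i j := rfl

theorem matrixUnitsHom_one (hmul : ∀ i j k l, W i j * W k l = if j = k then W i l else 0)
    (hstar : ∀ i j, star (W i j) = W j i) : matrixUnitsHom hmul hstar 1 = ∑ i, W i i := by
  simp [matrixUnitsHom_apply, Matrix.one_apply]

theorem matrixUnitsHom_injective (hmul : ∀ i j k l, W i j * W k l = if j = k then W i l else 0)
    (hstar : ∀ i j, star (W i j) = W j i) (hW : ∑ i, W i i ≠ 0) :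
    Function.Injective (matrixUnitsHom hmul hstar) := by
  refine (injective_iff_map_eq_zero _).mpr fun m hm => ?_
  ext i j
  -- Compress `m` to its `(i, j)` entry and move that to the diagonal.
  have h : ∀ k, W k i * matrixUnitsHom hmul hstar m * W j k = m i j • W k k := fun k => by
    simp [matrixUnitsHom_apply, Finset.mul_sum, Finset.sum_mul, hmul, mul_smul_comm,
      smul_mul_assoc]
  have h' : m i j • ∑ k, W k k = 0 := by
    rw [Finset.smul_sum]
    exact Finset.sum_eq_zero fun k _ => by rw [← h, hm, mul_zero, zero_mul]
  exact (smul_eq_zero.mp h').resolve_right hW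

end MatrixUnits

section UniformlyMcDuff

open TracialUltrapower

theorem exists_incl_ne_zero {A : Type u} [NonUnitalCStarAlgebra A] (ω : Ultrafilter ℕ)
    (hT : (traceSpace A).Nonempty) : ∃ a : A, incl ω (Set.univ : Set (traceSpace A)) a ≠ 0 := by
  by_contra! hcon
  obtain ⟨σ, hσ⟩ := hT
  have h : ∀ a, σ a = 0 := fun a => by
    have h1 := tendsto_limitTrace ω (fun _ => ⟨σ, hσ⟩) (constHom a)
    rw [← incl_eq_mk, hcon, map_zero] at h1
    exact tendsto_nhds_unique tendsto_const_nhds h1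
  have h0 : WeakDual.toStrongDual σ = 0 := ContinuousLinearMap.ext h
  have := hσ.2.1
  rw [h0, norm_zero] at this
  exact zero_ne_one this

theorem uniformTwoNorm_le {B : Type u} [NonUnitalCStarAlgebra B] (X : Set (traceSpace B)) (b : B) :
    uniformTwoNorm X b ≤ ‖b‖ :=
  Real.iSup_le (fun τ => twoNorm_le τ.1 b) (norm_nonneg b)

theorem exists_matrixUnits {A : Type u} [NonUnitalCStarAlgebra A] [PartialOrder A]
    [StarOrderedRing A] [TopologicalSpace.SeparableSpace A] {ω : Ultrafilter ℕ}
    (hω : (ω : Filter ℕ) ≤ cofinite) (hT : (traceSpace A).Nonempty)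
    (hTc : IsCompact (traceSpace A)) (hA : HasCPoU ω A) {n : ℕ}
    (h : ∀ σ : traceSpace A,
      MatrixEmbedsCentrally ω {gnsTrace σ} (Set.range (toGNSBicommutant σ)) n) :
    ∃ W : Fin n → Fin n → UniformUltrapower ω A,
      (∀ i j k l, W i j * W k l = if j = k then W i l else 0) ∧
      (∀ i j, star (W i j) = W j i) ∧ (∀ i j a, Commute (W i j) (incl ω _ a)) ∧
      IsUnitElement (∑ i, W i i) := by
  let d := TopologicalSpace.denseSeq A
  choose c hc1 hcr hcu using fun N : ℕ => exists_uniform_approximate_matrixUnits hω hT hTc hA h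
    (fun s : Fin N => d s) (Nat.one_div_pos_of_nat (α := ℝ) (n := N))
  have h0 : Tendsto (fun m : ℕ => 1 / ((m : ℝ) + 1)) ω (𝓝 0) :=
    tendsto_one_div_add_atTop_nhds_zero_nat.mono_left (hω.trans Nat.cofinite_eq_atTop.le)
  let C : Fin n → Fin n → ℓ^∞(ℕ, A) := fun i j =>
    boundedSeq (fun N => c N i j) fun N => hc1 N i j
  have hzero : ∀ y : ℓ^∞(ℕ, A), (∀ N, uniformTwoNorm Set.univ (y N) ≤ 1 / ((N : ℝ) + 1)) →
      mk ω Set.univ y = 0 := fun y hy =>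
    (mk_eq_zero ω _).mpr (squeeze_zero (fun N => uniformTwoNorm_nonneg _ _) hy h0)
  have hmul : ∀ i j k l, mk ω Set.univ (C i j) * mk ω _ (C k l) =
      if j = k then mk ω _ (C i l) else 0 := fun i j k l => by
    have h1 := hzero (C i j * C k l - if j = k then C i l else 0) fun N => by
      have h2 := hcr N (.inl (i, j, k, l))
      simp only [matrixDefect] at h2
      rw [← evalHom_apply, map_sub, map_mul]
      split_ifs at h2 ⊢
      · exact h2
      · rw [map_zero]; exact h2
    rw [map_sub, map_mul, sub_eq_zero] at h1
    rw [h1]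
    split_ifs <;> simp
  have hstar : ∀ i j, star (mk ω Set.univ (C i j)) = mk ω _ (C j i) := fun i j => by
    rw [← mk_star, ← sub_eq_zero, ← map_sub]
    exact hzero _ fun N => hcr N (.inr (.inl (i, j)))
  have hunit : ∀ z, (∑ i, mk ω Set.univ (C i i)) * z = z := fun z => by
    obtain ⟨x, rfl⟩ := mk_surjective ω _ z
    rw [← mk_sum, ← map_mul, mk_eq_mk]
    refine squeeze_zero (fun N => uniformTwoNorm_nonneg _ _) (fun N => ?_)
      (by simpa using h0.mul_const ‖x‖)
    rw [← evalHom_apply N (_ * x), map_mul, map_sum]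
    refine (hcu N (x N)).trans ?_
    have h1 := lp.norm_apply_le_norm (by simp) x N
    simp only [one_div]
    gcongr
  refine ⟨fun i j => mk ω _ (C i j), hmul, hstar, fun i j a => ?_, fun z => ⟨hunit z, ?_⟩⟩
  · rw [commute_iff_eq, incl_eq_mk, ← map_mul, ← map_mul, mk_eq_mk]
    refine Metric.tendsto_nhds.mpr fun ε hε => ?_
    obtain ⟨s, hs⟩ := (TopologicalSpace.denseRange_denseSeq A).exists_dist_lt a
      (show 0 < ε / 4 by positivity)
    filter_upwards [h0.eventually (gt_mem_nhds (show 0 < ε / 2 by positivity)),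
      hω.trans Nat.cofinite_eq_atTop.le (eventually_gt_atTop s)] with N hN hsN
    rw [Real.dist_0_eq_abs, abs_of_nonneg (uniformTwoNorm_nonneg _ _)]
    have h1 : uniformTwoNorm Set.univ (c N i j * d s - d s * c N i j) < ε / 2 :=
      (hcr N (.inr (.inr (i, j, ⟨s, hsN⟩)))).trans_lt hN
    have e1 : c N i j * a - a * c N i j = (c N i j * d s - d s * c N i j) +
        (c N i j * (a - d s) - (a - d s) * c N i j) := by noncomm_ring
    change uniformTwoNorm Set.univ (c N i j * a - a * c N i j) < ε
    rw [e1]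
    rw [dist_eq_norm] at hs
    have h2 : ‖c N i j * (a - d s) - (a - d s) * c N i j‖ ≤ ‖a - d s‖ + ‖a - d s‖ :=
      (norm_sub_le _ _).trans (add_le_add
        ((norm_mul_le _ _).trans (mul_le_of_le_one_left (norm_nonneg _) (hc1 N i j)))
        ((norm_mul_le _ _).trans (mul_le_of_le_one_right (norm_nonneg _) (hc1 N i j))))
    have h3 := uniformTwoNorm_le (Set.univ : Set (traceSpace A))
      (c N i j * (a - d s) - (a - d s) * c N i j)
    refine (uniformTwoNorm_add_le _ _ _).trans_lt ?_
    change ‖a - d s‖ < _ at hs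
    linarith
  · have h1 := congrArg star (hunit (star z))
    simpa [star_mul, star_sum, hstar] using h1

end UniformlyMcDuff

end UniformTracial

open UniformTracial TracialUltrapower in
theorem lemma4p4 {A : Type*} [NonUnitalCStarAlgebra A] [PartialOrder A] [StarOrderedRing A]
    [TopologicalSpace.SeparableSpace A] (ω : Ultrafilter ℕ) (hω : (ω : Filter ℕ) ≤ Filter.cofinite)
    (hT : (UniformTracial.traceSpace A).Nonempty) (hTc : IsCompact (UniformTracial.traceSpace A))
    (hA : UniformTracial.HasCPoU ω A)
    (hMcD : ∀ τ : UniformTracial.traceSpace A, UniformTracial.GNSIsMcDuff τ ω) :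
    UniformTracial.IsUniformlyMcDuff ω A := by
  intro n hn
  obtain ⟨W, hmul, hstar, hcomm, hunit⟩ := exists_matrixUnits hω hT hTc hA fun σ => hMcD σ n hn
  refine ⟨matrixUnitsHom hmul hstar, matrixUnitsHom_injective hmul hstar fun h0 => ?_, ?_, ?_⟩
  · obtain ⟨a, ha⟩ := exists_incl_ne_zero ω hT
    rw [← (hunit (incl ω _ a)).1, h0, zero_mul] at ha
    exact ha rfl
  · rwa [matrixUnitsHom_one]
  · rintro m _ ⟨a, -, rfl⟩
    rw [matrixUnitsHom_apply]
    exact Commute.sum_right _ _ _ fun i _ => Commute.sum_right _ _ _ fun j _ =>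
      ((hcomm i j a).symm.smul_right _)
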